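/- Let $n\ge 2$, let $\pi:\mathbb{R}^n\to\mathbb{R}$ and $\Pi:\mathbb{R}^{n+1}=\mathbb{R}^n\times\mathbb{R}\to\mathbb{R}$ be the projections onto the first coordinate. A \emph{domain of finite type} is a closed $C^\infty$ submanifold with boundary $\mathscr{D}\subset\mathbb{R}^n$ of dimension $n$ such that $\pi|_{\partial\mathscr{D}}$ is a Morse function with finitely many critical values and $\pi|_{\mathscr{D}}$ is proper. Given a set $X$, a function $f:X\to\mathbb{R}$ and a set $K\subset X$ of critical points, the \emph{Reeb space} of $f$ is the quotient space $X/{\sim}$, where $x\sim y$ if and only if $x,y$ lie in the same connected component of the same level set of $f$; $f$ induces a height function on it. The \emph{Reeb graph} is the following multigraph. Its vertices are the points of the Reeb space (i.e. the connected components of level sets) which contain a point of $K$. For vertices $v,w$ at heights $a<b$ there is one edge between $v$ and $w$ for each connected component of $f^{-1}(]a,b[)$ which contains no point of $K$ and whose closure meets both $v$ and $w$. There is an unbounded edge at a vertex $v$ at height $a$ for each unbounded connected component of $f^{-1}(]-\infty,a[)$ or of $f^{-1}(]a,+\infty[)$ which contains no point of $K$ and whose closure meets $v$, and an unbounded edge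 without vertices for each unbounded connected component of $X$ containing no point of $K$. The \emph{Poincaré–Reeb graph} $\mathcal{R}(\mathscr{D})$ is obtained from $X=\mathscr{D}$, $f=\pi|_{\mathscr{D}}$ and $K$ the set of critical points of $\pi|_{\partial\mathscr{D}}$. For a $C^\infty$ hypersurface $M\subset\mathbb{R}^{n+1}$, the Reeb graph $\mathcal{R}(\Pi|_M)$ is obtained from $X=M$, $f=\Pi|_M$ and $K$ the set of critical points of $\Pi|_M$. \textbf{Proposition.} Let $\mathscr{D}\subset\mathbb{R}^n$ be a domain of finite type whose Poincaré–Reeb graph has no unbounded edges, and let $\Gamma$ be a multigraph with an isomorphism $e:\Gamma\to\mathcal{R}(\mathscr{D})$. Then there is $h\in C^\infty(\mathbb{R}^n)$ with $\mathscr{D}=\{h\ge 0\}$, $\partial\mathscr{D}=\{h=0\}$ and $\nabla h(x)\ne 0$ for all $x\in\partial\mathscr{D}$. For every such $h$, the double $M=\{(x,y)\in\mathbb{R}^n\times\mathbb{R}\mid y^2=h(x)\}$ is a closed $C^\infty$ hypersurface of $\mathbb{R}^{n+1}$ such that: (i) $M$ intersects $\mathbb{R}^n\times\{0\}$ transversally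 and $M\cap(\mathbb{R}^n\times\{0\})=\partial\mathscr{D}\times\{0\}$; (ii) $\Pi|_M$ is a Morse function, and its Reeb graph $\mathcal{R}(\Pi|_M)$ has no unbounded edges and is isomorphic to $\Gamma$. More precisely, there are a height-preserving homeomorphism $\Theta$ from the Reeb space of $\pi|_{\mathscr{D}}$ to the Reeb space of $\Pi|_M$ and an isomorphism of multigraphs $e':\Gamma\to\mathcal{R}(\Pi|_M)$ such that $e'(v)=\Theta(e(v))$ for every vertex $v$ of $\Gamma$. -/

import Mathlib

open Set Topology
open scoped ContDiff

noncomputable section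

/-- The Euclidean space `ℝ^d`. -/
abbrev Euc (d : ℕ) : Type := EuclideanSpace ℝ (Fin d)

/-- The projection `ℝ^(d+1) → ℝ` onto the first coordinate. -/
def firstCoord (d : ℕ) (x : Euc (d + 1)) : ℝ := x 0

/-! ### Smooth hypersurfaces and smooth domains of `ℝ^(d+1)` -/

/-- `Φ` is a smooth diffeomorphism from an open neighbourhood of `p` in `ℝ^(d+1)` onto an open
subset of `ℝ^d × ℝ`. -/
structure IsSmoothChartAt {d : ℕ} (p : Euc (d + 1))
    (Φ : OpenPartialHomeomorph (Euc (d + 1)) (Euc d × ℝ)) : Prop where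
  mem_source : p ∈ Φ.source
  contDiffOn : ContDiffOn ℝ ∞ Φ Φ.source
  contDiffOn_symm : ContDiffOn ℝ ∞ Φ.symm Φ.target

/-- A flattening (slice) chart of `M` at `p`: near `p` it maps `M` to `ℝ^d × {0}`. -/
structure IsFlatteningChart {d : ℕ} (M : Set (Euc (d + 1))) (p : Euc (d + 1))
    (Φ : OpenPartialHomeomorph (Euc (d + 1)) (Euc d × ℝ)) : Prop
    extends IsSmoothChartAt p Φ where
  flat : ∀ x ∈ Φ.source, x ∈ M ↔ (Φ x).2 = 0

/-- `M` is an (embedded, boundaryless) `C^∞` submanifold of `ℝ^(d+1)` of dimension `d`. -/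
def IsSmoothHypersurface {d : ℕ} (M : Set (Euc (d + 1))) : Prop :=
  ∀ p ∈ M, ∃ Φ, IsFlatteningChart M p Φ

/-- `D` is a closed `C^∞` submanifold with boundary of `ℝ^(d+1)` of full dimension `d + 1`; its
manifold boundary is the topological boundary `frontier D`, at the points of which `D` is mapped
to the half-space `ℝ^d × [0, ∞)` by a chart. -/
def IsSmoothDomain {d : ℕ} (D : Set (Euc (d + 1))) : Prop :=
  IsClosed D ∧ ∀ p ∈ frontier D, ∃ Φ : OpenPartialHomeomorph (Euc (d + 1)) (Euc d × ℝ),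
    IsSmoothChartAt p Φ ∧ ∀ x ∈ Φ.source, x ∈ D ↔ 0 ≤ (Φ x).2

/-- `v` is a tangent vector of the hypersurface `M` at `p`. -/
def IsTangentVector {d : ℕ} (M : Set (Euc (d + 1))) (p v : Euc (d + 1)) : Prop :=
  ∃ Φ, IsFlatteningChart M p Φ ∧ (fderiv ℝ Φ p v).2 = 0

/-- The hypersurfaces `M` and `N` meet transversally: at every common point their tangent spaces
span the whole space. -/
def MeetTransversally {d : ℕ} (M N : Set (Euc (d + 1))) : Prop :=
  ∀ p ∈ M ∩ N, ∀ w : Euc (d + 1), ∃ u v,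
    IsTangentVector M p u ∧ IsTangentVector N p v ∧ w = u + v

/-! ### Critical points and Morse functions on a hypersurface -/

/-- The expression of `f|_M` in the local coordinates of `M` given by a flattening chart. -/
def localExpr {d : ℕ} (f : Euc (d + 1) → ℝ)
    (Φ : OpenPartialHomeomorph (Euc (d + 1)) (Euc d × ℝ)) (u : Euc d) : ℝ :=
  f (Φ.symm (u, 0))

/-- The set of critical points of the restriction of `f` to the hypersurface `M`. -/
def criticalSet {d : ℕ} (f : Euc (d + 1) → ℝ) (M : Set (Euc (d + 1))) : Set (Euc (d + 1)) :=
  {p | p ∈ M ∧ ∃ Φ, IsFlatteningChart M p Φ ∧ fderiv ℝ (localExpr f Φ) (Φ p).1 = 0}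

/-- The restriction of the smooth function `f` to the hypersurface `M` is a Morse function: at each
critical point its Hessian, computed in local coordinates, is nondegenerate. -/
def IsMorseOn {d : ℕ} (f : Euc (d + 1) → ℝ) (M : Set (Euc (d + 1))) : Prop :=
  ContDiff ℝ ∞ f ∧ ∀ p ∈ criticalSet f M, ∃ Φ, IsFlatteningChart M p Φ ∧
    ∀ v : Euc d, fderiv ℝ (fderiv ℝ (localExpr f Φ)) (Φ p).1 v = 0 → v = 0

/-! ### Domains of finite type -/

/-- `D ⊆ ℝ^(d+1)` is a domain of finite type. -/
structure IsDomainOfFiniteType {d : ℕ} (D : Set (Euc (d + 1))) : Prop where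
  smooth : IsSmoothDomain D
  morse : IsMorseOn (firstCoord d) (frontier D)
  finite_criticalValues : (firstCoord d '' criticalSet (firstCoord d) (frontier D)).Finite
  proper : IsProperMap (fun x : D => firstCoord d x)

/-! ### Reeb spaces and Reeb graphs

Here `X` is a subset of a topological space, `f` a real function whose restriction to `X` is
studied, and `K ⊆ X` the set of points regarded as critical. -/

section Reeb

variable {T : Type*} [TopologicalSpace T]

/-- Two points of `X` are equivalent if they lie in the same connected component of the same level
set of `f|_X`. -/
def reebSetoid (X : Set T) (f : T → ℝ) : Setoid X where
  r x y := (y : T) ∈ connectedComponentIn (X ∩ f ⁻¹' {f x}) x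
  iseqv :=
    { refl := fun x => mem_connectedComponentIn ⟨x.2, rfl⟩
      symm := by
        intro x y h
        have hf : f y = f x := (connectedComponentIn_subset _ _ h).2
        rw [hf, ← connectedComponentIn_eq h]
        exact mem_connectedComponentIn ⟨x.2, rfl⟩
      trans := by
        intro x y z h h'
        have hf : f y = f x := (connectedComponentIn_subset _ _ h).2
        rw [hf, ← connectedComponentIn_eq h] at h'
        exact h' }

/-- The Reeb space of `f|_X`, with the quotient topology. -/
abbrev ReebSpace (X : Set T) (f : T → ℝ) : Type _ := Quotient (reebSetoid X f)

/-- The function induced by `f` on the Reeb space. -/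
def reebHeight (X : Set T) (f : T → ℝ) : ReebSpace X f → ℝ :=
  Quotient.lift (fun x : X => f x)
    (fun _ _ h => ((connectedComponentIn_subset _ _ h).2 : f _ = f _).symm)

/-- The connected component of a level set which is represented by a point of the Reeb space. -/
def reebFiber (X : Set T) (f : T → ℝ) (q : ReebSpace X f) : Set T :=
  {x | ∃ hx : x ∈ X, (Quotient.mk _ ⟨x, hx⟩ : ReebSpace X f) = q}

/-- The vertices: the points of the Reeb space whose level component contains a critical point. -/
def reebVertices (X : Set T) (f : T → ℝ) (K : Set T) : Set (ReebSpace X f) :=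
  {q | (reebFiber X f q ∩ K).Nonempty}

/-- `C` is a connected component of the set `A`. -/
def IsComponentOf (C A : Set T) : Prop := ∃ x ∈ A, C = connectedComponentIn A x

/-- The triple `(v, w, C)` is a bounded edge: `v` and `w` are vertices, `v` lies below `w`, and `C`
is a connected component of the part of `X` strictly between the levels of `v` and `w` which
contains no critical point and whose closure meets the level components `v` and `w`. -/
def IsReebEdge (X : Set T) (f : T → ℝ) (K : Set T)
    (e : ReebSpace X f × ReebSpace X f × Set T) : Prop :=
  e.1 ∈ reebVertices X f K ∧ e.2.1 ∈ reebVertices X f K ∧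
    reebHeight X f e.1 < reebHeight X f e.2.1 ∧
    IsComponentOf e.2.2 (X ∩ f ⁻¹' Ioo (reebHeight X f e.1) (reebHeight X f e.2.1)) ∧
    Disjoint e.2.2 K ∧
    (closure e.2.2 ∩ reebFiber X f e.1).Nonempty ∧
    (closure e.2.2 ∩ reebFiber X f e.2.1).Nonempty

/-- The multigraph of vertices and bounded edges on the Reeb space of `f|_X`. -/
def reebGraph (X : Set T) (f : T → ℝ) (K : Set T) :
    Graph (ReebSpace X f) (ReebSpace X f × ReebSpace X f × Set T) where
  vertexSet := reebVertices X f K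
  IsLink e p q := IsReebEdge X f K e ∧ ((p = e.1 ∧ q = e.2.1) ∨ (p = e.2.1 ∧ q = e.1))
  isLink_symm := by
    rintro e -
    exact ⟨fun p q h => ⟨h.1, h.2.symm.imp And.symm And.symm⟩⟩
  eq_or_eq_of_isLink_of_isLink := by
    rintro e x y v w ⟨-, h⟩ ⟨-, h'⟩
    rcases h with ⟨rfl, rfl⟩ | ⟨rfl, rfl⟩ <;> rcases h' with ⟨rfl, rfl⟩ | ⟨rfl, rfl⟩ <;> simp
  left_mem_of_isLink := by
    rintro e x y ⟨h, ⟨rfl, -⟩ | ⟨rfl, -⟩⟩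
    exacts [h.1, h.2.1]

end Reeb

/-- `C` is an unbounded edge issuing from the vertex `v`: an unbounded connected component of the
part of `X` strictly below, or strictly above, the level of `v`, which contains no critical point
and whose closure meets the level component `v`. -/
def IsUnboundedEdgeAt {d : ℕ} (X : Set (Euc d)) (f : Euc d → ℝ) (K : Set (Euc d))
    (v : ReebSpace X f) (C : Set (Euc d)) : Prop :=
  v ∈ reebVertices X f K ∧
    (IsComponentOf C (X ∩ f ⁻¹' Iio (reebHeight X f v)) ∨
      IsComponentOf C (X ∩ f ⁻¹' Ioi (reebHeight X f v))) ∧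
    ¬ Bornology.IsBounded C ∧ Disjoint C K ∧ (closure C ∩ reebFiber X f v).Nonempty

/-- `C` is an unbounded edge without vertices: an unbounded connected component of `X` without
critical points. -/
def IsUnboundedEdgeFree {d : ℕ} (X : Set (Euc d)) (K : Set (Euc d)) (C : Set (Euc d)) : Prop :=
  IsComponentOf C X ∧ ¬ Bornology.IsBounded C ∧ Disjoint C K

/-- The Reeb graph of `f|_X` has no unbounded edges, so that `reebGraph X f K` is all of it. -/
def HasNoUnboundedEdges {d : ℕ} (X : Set (Euc d)) (f : Euc d → ℝ) (K : Set (Euc d)) : Prop :=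
  (∀ v C, ¬ IsUnboundedEdgeAt X f K v C) ∧ ∀ C, ¬ IsUnboundedEdgeFree X K C

/-- An isomorphism of multigraphs: bijections of vertices and of edges preserving incidence. -/
structure MultigraphIso {α β α' β' : Type*} (G : Graph α β) (H : Graph α' β') where
  vertexEquiv : G.vertexSet ≃ H.vertexSet
  edgeEquiv : G.edgeSet ≃ H.edgeSet
  isLink_iff : ∀ (e : G.edgeSet) (x y : G.vertexSet),
    G.IsLink e x y ↔ H.IsLink (edgeEquiv e) (vertexEquiv x) (vertexEquiv y)

/-- The Poincaré-Reeb space `D/∼` of a domain `D`. -/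
abbrev PRSpace {d : ℕ} (D : Set (Euc (d + 1))) : Type := ReebSpace D (firstCoord d)

/-- The Poincaré-Reeb graph of a domain `D`, whose vertices come from the critical points of the
first coordinate on the boundary. -/
def poincareReebGraph {d : ℕ} (D : Set (Euc (d + 1))) :
    Graph (PRSpace D) (PRSpace D × PRSpace D × Set (Euc (d + 1))) :=
  reebGraph D (firstCoord d) (criticalSet (firstCoord d) (frontier D))

/-- The Reeb graph of the restriction of `f` to the hypersurface `M`, whose vertices come from the
critical points of `f|_M`. -/
def hypersurfaceReebGraph {d : ℕ} (M : Set (Euc (d + 1))) (f : Euc (d + 1) → ℝ) :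
    Graph (ReebSpace M f) (ReebSpace M f × ReebSpace M f × Set (Euc (d + 1))) :=
  reebGraph M f (criticalSet f M)

/-! ### The double -/

/-- `h` is a global smooth regular defining function of `D`. -/
structure IsDefiningFunction {m : ℕ} (D : Set (Euc m)) (h : Euc m → ℝ) : Prop where
  contDiff : ContDiff ℝ ∞ h
  eq_nonneg : D = {x | 0 ≤ h x}
  frontier_eq : frontier D = {x | h x = 0}
  regular : ∀ x ∈ frontier D, fderiv ℝ h x ≠ 0

/-- The projection `ℝ^m × ℝ = ℝ^(m+1) → ℝ^m`, `(x, y) ↦ x`. -/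
def dropLast {m : ℕ} (p : Euc (m + 1)) : Euc m := WithLp.toLp 2 (fun i : Fin m => p i.castSucc)

/-- The subset `S × {0}` of `ℝ^m × ℝ = ℝ^(m+1)`. -/
def prodZero {m : ℕ} (S : Set (Euc m)) : Set (Euc (m + 1)) :=
  {p | dropLast p ∈ S ∧ p (Fin.last m) = 0}

/-- The double `{(x, y) ∈ ℝ^m × ℝ | y² = h x}`. -/
def doubleHypersurface {m : ℕ} (h : Euc m → ℝ) : Set (Euc (m + 1)) :=
  {p | p (Fin.last m) ^ 2 = h (dropLast p)}

end

/-! The projection (x, y) ↦ x maps M onto D with fibre {±√(h x)} over x, so M is two copies of D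
glued along ∂D. By properness the slices {π = t} of D are bounded, and since n ≥ 2 each slice
contains a ray direction; hence every component of a slice reaches ∂D
(`IsDomainOfFiniteType.exists_mem_frontier`). There √h vanishes, so the lifts of the component by √h
and by -√h share a point and their union is connected. Each point of M is thus joined, inside its
level component, to the section x ↦ (x, √(h x)).

`IsReebProjection` isolates this property. It alone implies that, for any set I of heights, the
components of M over I are exactly the preimages of the components of D over I
(`connectedComponentIn_eq_preimage`). With I a point, an interval, a half-line or ℝ, this transfers
Reeb points, edges and unbounded edges.

For the differential part, ∂D and M are the regular zero sets of h and of F = y² - h.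
`mem_criticalSet_iff` and `isMorseOn_iff` translate the chart definitions into conditions on first
and second derivatives of the defining function. Critical points of Π on M are those of π on ∂D,
placed at y = 0, and the Hessian of F is that of -h plus the nondegenerate term 2dy².

The function h itself comes from a partition of unity: local defining functions agree in sign, so no
cancellation can occur in the sum. -/

noncomputable section

/-! ### Transfer of Reeb graphs along a projection with a section -/

/-- The map `q` projects `Y` onto `X` compatibly with the functions `g` and `f`, it has the
continuous section `s`, and every point `y` of `Y` lies in the same component of its level set as
the point `s (q y)`. -/
structure IsReebProjection {T S : Type*} [TopologicalSpace T] [TopologicalSpace S]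
    (X : Set T) (f : T → ℝ) (Y : Set S) (g : S → ℝ) (q : S → T) (s : T → S) : Prop where
  continuous_proj : Continuous q
  continuous_section : Continuous s
  mapsTo_proj : MapsTo q Y X
  mapsTo_section : MapsTo s X Y
  proj_section : ∀ x, q (s x) = x
  height : ∀ y, f (q y) = g y
  section_mem : ∀ y ∈ Y, s (q y) ∈ connectedComponentIn (Y ∩ g ⁻¹' {g y}) y

namespace IsReebProjection

variable {T S : Type*} [TopologicalSpace T] [TopologicalSpace S]
  {X : Set T} {f : T → ℝ} {Y : Set S} {g : S → ℝ} {q : S → T} {s : T → S}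

theorem height_section (H : IsReebProjection X f Y g q s) (x : T) : g (s x) = f x := by
  rw [← H.height, H.proj_section]

/-- The image `s '' C` is connected, and the level component of any y over C lies over C and meets
that image at `s (q y)`. The preimage is the union of these connected sets. -/
theorem isPreconnected_preimage (H : IsReebProjection X f Y g q s) {I : Set ℝ} {C : Set T}
    (hC : IsComponentOf C (X ∩ f ⁻¹' I)) : IsPreconnected (Y ∩ q ⁻¹' C) := by
  obtain ⟨x₀, hx₀, rfl⟩ := hC
  set A := X ∩ f ⁻¹' I
  have hCA : connectedComponentIn A x₀ ⊆ A := connectedComponentIn_subset _ _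
  have hs : IsPreconnected (s '' connectedComponentIn A x₀) :=
    isPreconnected_connectedComponentIn.image _ H.continuous_section.continuousOn
  refine isPreconnected_of_forall (s x₀) fun y hy => ?_
  have hyY : y ∈ Y ∩ g ⁻¹' {g y} := ⟨hy.1, rfl⟩
  have hsub : connectedComponentIn (Y ∩ g ⁻¹' {g y}) y ⊆ Y ∩ q ⁻¹' connectedComponentIn A x₀ := by
    refine fun z hz => ⟨(connectedComponentIn_subset _ _ hz).1, ?_⟩
    have hq : q '' connectedComponentIn (Y ∩ g ⁻¹' {g y}) y ⊆ connectedComponentIn A (q y) := by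
      refine (isPreconnected_connectedComponentIn.image _
        H.continuous_proj.continuousOn).subset_connectedComponentIn
          ⟨y, mem_connectedComponentIn hyY, rfl⟩ ?_
      rintro _ ⟨w, hw, rfl⟩
      obtain ⟨hw1, hw2⟩ := connectedComponentIn_subset _ _ hw
      refine ⟨H.mapsTo_proj hw1, ?_⟩
      have h2 := (hCA hy.2).2
      simp only [mem_preimage, mem_singleton_iff] at hw2 h2 ⊢
      rwa [H.height, hw2, ← H.height]
    rw [mem_preimage, connectedComponentIn_eq hy.2]
    exact hq ⟨z, hz, rfl⟩
  refine ⟨s '' connectedComponentIn A x₀ ∪ connectedComponentIn (Y ∩ g ⁻¹' {g y}) y, ?_,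
    Or.inl ⟨x₀, mem_connectedComponentIn hx₀, rfl⟩, Or.inr (mem_connectedComponentIn hyY),
    hs.union (s (q y)) ⟨q y, hy.2, rfl⟩ (H.section_mem y hy.1) isPreconnected_connectedComponentIn⟩
  refine union_subset ?_ hsub
  rintro _ ⟨x, hx, rfl⟩
  exact ⟨H.mapsTo_section (hCA hx).1, by rwa [mem_preimage, H.proj_section]⟩

/-- One inclusion pushes a connected set forward by `q`, the other is `isPreconnected_preimage`.
Leaving `I` arbitrary covers all the components that enter the definition of a Reeb graph. -/
theorem connectedComponentIn_eq_preimage (H : IsReebProjection X f Y g q s) {I : Set ℝ} {y : S}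
    (hy : y ∈ Y ∩ g ⁻¹' I) :
    connectedComponentIn (Y ∩ g ⁻¹' I) y = Y ∩ q ⁻¹' connectedComponentIn (X ∩ f ⁻¹' I) (q y) := by
  have hqy : q y ∈ X ∩ f ⁻¹' I := ⟨H.mapsTo_proj hy.1, by simpa [H.height] using hy.2⟩
  apply Subset.antisymm
  · refine fun z hz => ⟨(connectedComponentIn_subset _ _ hz).1, ?_⟩
    refine (isPreconnected_connectedComponentIn.image _
        H.continuous_proj.continuousOn).subset_connectedComponentIn
          ⟨y, mem_connectedComponentIn hy, rfl⟩ ?_ ⟨z, hz, rfl⟩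
    rintro _ ⟨w, hw, rfl⟩
    obtain ⟨hw1, hw2⟩ := connectedComponentIn_subset _ _ hw
    exact ⟨H.mapsTo_proj hw1, by simpa [H.height] using hw2⟩
  · refine (H.isPreconnected_preimage ⟨q y, hqy, rfl⟩).subset_connectedComponentIn
      ⟨hy.1, mem_connectedComponentIn hqy⟩ ?_
    refine fun z hz => ⟨hz.1, ?_⟩
    have := (connectedComponentIn_subset _ _ hz.2).2
    simpa [H.height] using this

theorem isComponentOf_preimage (H : IsReebProjection X f Y g q s) {I : Set ℝ} {C : Set T}
    (hC : IsComponentOf C (X ∩ f ⁻¹' I)) : IsComponentOf (Y ∩ q ⁻¹' C) (Y ∩ g ⁻¹' I) := by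
  obtain ⟨x, hx, rfl⟩ := hC
  have hsx : s x ∈ Y ∩ g ⁻¹' I :=
    ⟨H.mapsTo_section hx.1, by simpa [H.height_section] using hx.2⟩
  exact ⟨s x, hsx, by rw [H.connectedComponentIn_eq_preimage hsx, H.proj_section]⟩

theorem exists_isComponentOf (H : IsReebProjection X f Y g q s) {I : Set ℝ} {C : Set S}
    (hC : IsComponentOf C (Y ∩ g ⁻¹' I)) :
    ∃ C', IsComponentOf C' (X ∩ f ⁻¹' I) ∧ C = Y ∩ q ⁻¹' C' := by
  obtain ⟨y, hy, rfl⟩ := hC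
  exact ⟨_, ⟨q y, ⟨H.mapsTo_proj hy.1, by simpa [H.height] using hy.2⟩, rfl⟩,
    H.connectedComponentIn_eq_preimage hy⟩

theorem setoid_iff (H : IsReebProjection X f Y g q s) (y z : Y) :
    reebSetoid Y g y z ↔ reebSetoid X f ⟨q y, H.mapsTo_proj y.2⟩ ⟨q z, H.mapsTo_proj z.2⟩ := by
  change (z : S) ∈ connectedComponentIn (Y ∩ g ⁻¹' {g y}) y ↔
    q z ∈ connectedComponentIn (X ∩ f ⁻¹' {f (q y)}) (q y)
  rw [H.connectedComponentIn_eq_preimage (I := {g y}) ⟨y.2, rfl⟩, H.height]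
  exact ⟨fun h => h.2, fun h => ⟨z.2, h⟩⟩

/-- The homeomorphism of Reeb spaces induced by the section. -/
def reebHomeomorph (H : IsReebProjection X f Y g q s) : ReebSpace X f ≃ₜ ReebSpace Y g where
  toFun := Quotient.map' (fun x : X => (⟨s x, H.mapsTo_section x.2⟩ : Y)) (fun x z h => by
    have h' := (H.setoid_iff ⟨s x, H.mapsTo_section x.2⟩ ⟨s z, H.mapsTo_section z.2⟩).2
    simp only [H.proj_section] at h'
    exact h' h)
  invFun := Quotient.map' (fun y : Y => (⟨q y, H.mapsTo_proj y.2⟩ : X))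
    (fun y z h => (H.setoid_iff y z).1 h)
  left_inv := by
    rintro ⟨x⟩
    exact congrArg (Quotient.mk _) (Subtype.ext (H.proj_section x))
  right_inv := by
    rintro ⟨y⟩
    refine Quotient.sound ((H.setoid_iff _ _).2 ?_)
    have h : (⟨q (s (q y)), H.mapsTo_proj (H.mapsTo_section (H.mapsTo_proj y.2))⟩ : X) =
      ⟨q y, H.mapsTo_proj y.2⟩ := Subtype.ext (H.proj_section _)
    simp only [h]
    exact (reebSetoid X f).refl _
  continuous_toFun := Continuous.quotient_map'
    (H.continuous_section.comp continuous_subtype_val |>.subtype_mk _) _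
  continuous_invFun := Continuous.quotient_map'
    (H.continuous_proj.comp continuous_subtype_val |>.subtype_mk _) _

theorem reebHeight_reebHomeomorph (H : IsReebProjection X f Y g q s) (v : ReebSpace X f) :
    reebHeight Y g (H.reebHomeomorph v) = reebHeight X f v := by
  obtain ⟨x⟩ := v
  exact H.height_section x

theorem reebFiber_reebHomeomorph (H : IsReebProjection X f Y g q s) (v : ReebSpace X f) :
    reebFiber Y g (H.reebHomeomorph v) = Y ∩ q ⁻¹' reebFiber X f v := by
  ext y
  constructor
  · rintro ⟨hy, h⟩
    refine ⟨hy, H.mapsTo_proj hy, ?_⟩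
    rw [← H.reebHomeomorph.symm_apply_eq] at h
    exact h
  · rintro ⟨hy, _, h⟩
    refine ⟨hy, ?_⟩
    rw [← H.reebHomeomorph.symm_apply_eq]
    exact h

/-- Closure points are pushed down by `q` and lifted by `s`; continuity of both maps suffices. -/
theorem closure_inter_reebFiber_iff (H : IsReebProjection X f Y g q s) {C : Set T} (hC : C ⊆ X)
    (v : ReebSpace X f) :
    (closure (Y ∩ q ⁻¹' C) ∩ reebFiber Y g (H.reebHomeomorph v)).Nonempty ↔
      (closure C ∩ reebFiber X f v).Nonempty := by
  rw [H.reebFiber_reebHomeomorph]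
  constructor
  · rintro ⟨y, hy, -, hv⟩
    exact ⟨q y, map_mem_closure H.continuous_proj hy fun z hz => hz.2, hv⟩
  · rintro ⟨x, hx, hv⟩
    refine ⟨s x, map_mem_closure H.continuous_section hx fun z hz => ?_,
      H.mapsTo_section hv.1, ?_⟩
    · exact ⟨H.mapsTo_section (hC hz), by rwa [mem_preimage, H.proj_section]⟩
    · rwa [mem_preimage, H.proj_section]

variable {K : Set T} {L : Set S}

theorem reebHomeomorph_mem_reebVertices_iff (H : IsReebProjection X f Y g q s)
    (hq : MapsTo q L K) (hs : MapsTo s K L) (v : ReebSpace X f) :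
    H.reebHomeomorph v ∈ reebVertices Y g L ↔ v ∈ reebVertices X f K := by
  simp only [reebVertices, mem_ofPred_eq, H.reebFiber_reebHomeomorph]
  constructor
  · rintro ⟨y, ⟨-, hv⟩, hy⟩
    exact ⟨q y, hv, hq hy⟩
  · rintro ⟨x, hv, hx⟩
    exact ⟨s x, ⟨H.mapsTo_section hv.1, by rwa [mem_preimage, H.proj_section]⟩, hs hx⟩

theorem disjoint_preimage_iff (H : IsReebProjection X f Y g q s)
    (hq : MapsTo q L K) (hs : MapsTo s K L) {C : Set T} (hC : C ⊆ X) :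
    Disjoint (Y ∩ q ⁻¹' C) L ↔ Disjoint C K := by
  rw [Set.disjoint_left, Set.disjoint_left]
  constructor
  · exact fun h x hx hK => h
      ⟨H.mapsTo_section (hC hx), by rwa [mem_preimage, H.proj_section]⟩ (hs hK)
  · exact fun h y hy hL => h hy.2 (hq hL)

/-- The bijection between the candidates for edges. -/
def edgeMap (H : IsReebProjection X f Y g q s) (e : ReebSpace X f × ReebSpace X f × Set T) :
    ReebSpace Y g × ReebSpace Y g × Set S :=
  (H.reebHomeomorph e.1, H.reebHomeomorph e.2.1, Y ∩ q ⁻¹' e.2.2)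

theorem _root_.IsComponentOf.subset {C A : Set T} (h : IsComponentOf C A) : C ⊆ A := by
  obtain ⟨x, -, rfl⟩ := h
  exact connectedComponentIn_subset _ _

/-- The section makes `q` map `Y` onto `X`, so a subset of `X` is recovered from its preimage. -/
theorem eq_of_preimage_eq (H : IsReebProjection X f Y g q s) {A B : Set T} (hA : A ⊆ X)
    (hB : B ⊆ X) (h : Y ∩ q ⁻¹' A = Y ∩ q ⁻¹' B) : A = B := by
  have key : ∀ {A B : Set T}, A ⊆ X → Y ∩ q ⁻¹' A = Y ∩ q ⁻¹' B → A ⊆ B := fun hA h x hx => by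
    have := (h.subset ⟨H.mapsTo_section (hA hx), by rwa [mem_preimage, H.proj_section]⟩).2
    rwa [mem_preimage, H.proj_section] at this
  exact Subset.antisymm (key hA h) (key hB h.symm)

theorem isComponentOf_preimage_iff (H : IsReebProjection X f Y g q s) {I : Set ℝ} {C : Set T}
    (hC : C ⊆ X) :
    IsComponentOf (Y ∩ q ⁻¹' C) (Y ∩ g ⁻¹' I) ↔ IsComponentOf C (X ∩ f ⁻¹' I) := by
  refine ⟨fun h => ?_, H.isComponentOf_preimage⟩
  obtain ⟨C', hC', h⟩ := H.exists_isComponentOf h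
  rwa [H.eq_of_preimage_eq hC (hC'.subset.trans inter_subset_left) h]

theorem isReebEdge_edgeMap_iff (H : IsReebProjection X f Y g q s)
    (hq : MapsTo q L K) (hs : MapsTo s K L) {e : ReebSpace X f × ReebSpace X f × Set T}
    (he : e.2.2 ⊆ X) : IsReebEdge Y g L (H.edgeMap e) ↔ IsReebEdge X f K e := by
  simp only [IsReebEdge, edgeMap, H.reebHomeomorph_mem_reebVertices_iff hq hs,
    H.reebHeight_reebHomeomorph, H.isComponentOf_preimage_iff he, H.disjoint_preimage_iff hq hs he,
    H.closure_inter_reebFiber_iff he]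

theorem _root_.IsReebEdge.subset {e : ReebSpace X f × ReebSpace X f × Set T}
    (h : IsReebEdge X f K e) : e.2.2 ⊆ X :=
  h.2.2.2.1.subset.trans inter_subset_left

theorem _root_.mem_edgeSet_reebGraph {e : ReebSpace X f × ReebSpace X f × Set T} :
    e ∈ (reebGraph X f K).edgeSet ↔ IsReebEdge X f K e :=
  ⟨fun ⟨_, _, h⟩ => h.1, fun h => ⟨e.1, e.2.1, h, Or.inl ⟨rfl, rfl⟩⟩⟩

theorem edgeMap_bijective (H : IsReebProjection X f Y g q s)
    (hq : MapsTo q L K) (hs : MapsTo s K L) :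
    Function.Bijective (fun e : (reebGraph X f K).edgeSet =>
      (⟨H.edgeMap e, mem_edgeSet_reebGraph.2 ((H.isReebEdge_edgeMap_iff hq hs
        (mem_edgeSet_reebGraph.1 e.2).subset).2 (mem_edgeSet_reebGraph.1 e.2))⟩ :
        (reebGraph Y g L).edgeSet)) := by
  constructor
  · rintro ⟨⟨v, w, C⟩, he⟩ ⟨⟨v', w', C'⟩, he'⟩ h
    have hC := (mem_edgeSet_reebGraph.1 he).subset
    have hC' := (mem_edgeSet_reebGraph.1 he').subset
    simp only [edgeMap, Subtype.mk.injEq, Prod.mk.injEq, EmbeddingLike.apply_eq_iff_eq] at h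
    obtain ⟨rfl, rfl, h⟩ := h
    have : C = C' := H.eq_of_preimage_eq hC hC' h
    subst this
    rfl
  · rintro ⟨⟨v, w, C⟩, he⟩
    have hE := mem_edgeSet_reebGraph.1 he
    obtain ⟨v, rfl⟩ := H.reebHomeomorph.surjective v
    obtain ⟨w, rfl⟩ := H.reebHomeomorph.surjective w
    obtain ⟨C, hC, rfl⟩ := H.exists_isComponentOf hE.2.2.2.1
    exact ⟨⟨(v, w, C), mem_edgeSet_reebGraph.2 ((H.isReebEdge_edgeMap_iff hq hs
      (e := (v, w, C)) (hC.subset.trans inter_subset_left)).1 hE)⟩, rfl⟩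

/-- The isomorphism of Reeb graphs induced by a Reeb projection. -/
def multigraphIso (H : IsReebProjection X f Y g q s) (hq : MapsTo q L K) (hs : MapsTo s K L) :
    MultigraphIso (reebGraph X f K) (reebGraph Y g L) where
  vertexEquiv := H.reebHomeomorph.toEquiv.subtypeEquiv
    fun v => (H.reebHomeomorph_mem_reebVertices_iff hq hs v).symm
  edgeEquiv := Equiv.ofBijective _ (H.edgeMap_bijective hq hs)
  isLink_iff := by
    rintro ⟨e, he⟩ ⟨v, hv⟩ ⟨w, hw⟩
    change IsReebEdge X f K e ∧ ((v = e.1 ∧ w = e.2.1) ∨ (v = e.2.1 ∧ w = e.1)) ↔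
      IsReebEdge Y g L (H.edgeMap e) ∧
        ((H.reebHomeomorph v = H.reebHomeomorph e.1 ∧
          H.reebHomeomorph w = H.reebHomeomorph e.2.1) ∨
        (H.reebHomeomorph v = H.reebHomeomorph e.2.1 ∧
          H.reebHomeomorph w = H.reebHomeomorph e.1))
    simp only [H.isReebEdge_edgeMap_iff hq hs (mem_edgeSet_reebGraph.1 he).subset,
      EmbeddingLike.apply_eq_iff_eq]

end IsReebProjection

/-- Composition of isomorphisms of multigraphs. -/
def MultigraphIso.trans {α β α' β' α'' β'' : Type*} {G : Graph α β} {H : Graph α' β'}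
    {J : Graph α'' β''} (e : MultigraphIso G H) (e' : MultigraphIso H J) : MultigraphIso G J where
  vertexEquiv := e.vertexEquiv.trans e'.vertexEquiv
  edgeEquiv := e.edgeEquiv.trans e'.edgeEquiv
  isLink_iff x y z := (e.isLink_iff x y z).trans (e'.isLink_iff _ _ _)

/-! ### Charts of regular zero sets -/

/-- The chain rule applied to both composites of the chart and its inverse shows that their
derivatives are mutually inverse. -/
theorem IsSmoothChartAt.exists_fderiv_equiv {d : ℕ} {p x : Euc (d + 1)}
    {Φ : OpenPartialHomeomorph (Euc (d + 1)) (Euc d × ℝ)} (hΦ : IsSmoothChartAt p Φ)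
    (hx : x ∈ Φ.source) : ∃ L : Euc (d + 1) ≃L[ℝ] Euc d × ℝ,
      HasFDerivAt Φ (L : Euc (d + 1) →L[ℝ] Euc d × ℝ) x ∧
      HasFDerivAt Φ.symm (L.symm : Euc d × ℝ →L[ℝ] Euc (d + 1)) (Φ x) := by
  have h1 : DifferentiableAt ℝ Φ x :=
    (hΦ.contDiffOn.contDiffAt (Φ.open_source.mem_nhds hx)).differentiableAt (by simp)
  have h2 : DifferentiableAt ℝ Φ.symm (Φ x) :=
    (hΦ.contDiffOn_symm.contDiffAt
      (Φ.open_target.mem_nhds (Φ.map_source hx))).differentiableAt (by simp)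
  have e1 : fderiv ℝ Φ.symm (Φ x) ∘L fderiv ℝ Φ x = ContinuousLinearMap.id ℝ _ := by
    have := (h2.hasFDerivAt.comp x h1.hasFDerivAt)
    refine this.unique ((hasFDerivAt_id x).congr_of_eventuallyEq ?_)
    exact Φ.eventually_left_inverse hx
  have e2 : fderiv ℝ Φ x ∘L fderiv ℝ Φ.symm (Φ x) = ContinuousLinearMap.id ℝ _ := by
    have h1' : HasFDerivAt Φ (fderiv ℝ Φ x) (Φ.symm (Φ x)) := by
      rw [Φ.left_inv hx]; exact h1.hasFDerivAt
    refine (h1'.comp (Φ x) h2.hasFDerivAt).unique ((hasFDerivAt_id _).congr_of_eventuallyEq ?_)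
    exact Φ.eventually_right_inverse (Φ.map_source hx)
  refine ⟨ContinuousLinearEquiv.equivOfInverse (fderiv ℝ Φ x) (fderiv ℝ Φ.symm (Φ x))
    (fun v => DFunLike.congr_fun e1 v) (fun v => DFunLike.congr_fun e2 v), ?_, ?_⟩
  · exact h1.hasFDerivAt
  · exact h2.hasFDerivAt

/-- For w with l w = 1 the space splits as ker l ⊕ ℝw, and ker l has dimension d. -/
theorem exists_continuousLinearEquiv_snd_eq {d : ℕ} {l : Euc (d + 1) →L[ℝ] ℝ} (hl : l ≠ 0) :
    ∃ L : Euc (d + 1) ≃L[ℝ] Euc d × ℝ, ∀ v, (L v).2 = l v := by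
  obtain ⟨w, hw⟩ : ∃ w, l w = 1 := by
    obtain ⟨v, hv⟩ := DFunLike.ne_iff.1 hl
    exact ⟨(l v)⁻¹ • v, by simpa using inv_mul_cancel₀ hv⟩
  have hsurj : Function.Surjective (l : Euc (d + 1) →ₗ[ℝ] ℝ) := fun t => ⟨t • w, by simp [hw]⟩
  have hker : Module.finrank ℝ (LinearMap.ker (l : Euc (d + 1) →ₗ[ℝ] ℝ)) = d := by
    have := LinearMap.finrank_range_add_finrank_ker (l : Euc (d + 1) →ₗ[ℝ] ℝ)
    rw [LinearMap.range_eq_top.2 hsurj, finrank_top, Module.finrank_self,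
      finrank_euclideanSpace_fin] at this
    omega
  obtain e : LinearMap.ker (l : Euc (d + 1) →ₗ[ℝ] ℝ) ≃ₗ[ℝ] Euc d :=
    LinearEquiv.ofFinrankEq _ _ (by rw [hker, finrank_euclideanSpace_fin])
  have hmem : ∀ v, v - l v • w ∈ LinearMap.ker (l : Euc (d + 1) →ₗ[ℝ] ℝ) := fun v => by
    simp [hw]
  let L : Euc (d + 1) →ₗ[ℝ] Euc d × ℝ :=
    { toFun := fun v => (e ⟨v - l v • w, hmem v⟩, l v)
      map_add' := fun u v => Prod.ext (by
        change e _ = e _ + e _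
        rw [← map_add]
        refine congrArg e (Subtype.ext ?_)
        simp only [map_add, add_smul, Submodule.coe_add]
        abel) (map_add l u v)
      map_smul' := fun c v => Prod.ext (by
        change e _ = c • e _
        rw [← map_smul]
        refine congrArg e (Subtype.ext ?_)
        simp [smul_sub, smul_smul]) (map_smul l c v) }
  have hinj : Function.Injective L := by
    rw [← LinearMap.ker_eq_bot, LinearMap.ker_eq_bot']
    intro v hv
    have h2 : l v = 0 := congrArg Prod.snd hv
    have h1 : e ⟨v - l v • w, hmem v⟩ = 0 := congrArg Prod.fst hv
    rw [LinearEquiv.map_eq_zero_iff, Submodule.mk_eq_zero, h2] at h1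
    simpa using h1
  have hfin : Module.finrank ℝ (Euc (d + 1)) = Module.finrank ℝ (Euc d × ℝ) := by simp
  refine ⟨(LinearEquiv.ofInjectiveOfFinrankEq L hinj hfin).toContinuousLinearEquiv, fun v => ?_⟩
  rfl

/-- A zero set is flattened near its regular points. -/
theorem exists_isFlatteningChart {d : ℕ} {M : Set (Euc (d + 1))} {F : Euc (d + 1) → ℝ}
    (hF : ContDiff ℝ ∞ F) (hM : ∀ x, x ∈ M ↔ F x = 0) {p : Euc (d + 1)}
    (hp : fderiv ℝ F p ≠ 0) : ∃ Φ, IsFlatteningChart M p Φ := by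
  obtain ⟨L, hL⟩ := exists_continuousLinearEquiv_snd_eq hp
  let P : Euc (d + 1) →L[ℝ] Euc d :=
    (ContinuousLinearMap.fst ℝ (Euc d) ℝ).comp (L : Euc (d + 1) →L[ℝ] Euc d × ℝ)
  let Q : Euc (d + 1) → Euc d × ℝ := fun x => (P x, F x)
  have hQ : ContDiff ℝ ∞ Q := P.contDiff.prodMk hF
  have hQ' : ∀ x, HasFDerivAt Q (P.prod (fderiv ℝ F x)) x := fun x =>
    P.hasFDerivAt.prodMk (hF.differentiable (by simp) x).hasFDerivAt
  have hQp : HasFDerivAt Q (L : Euc (d + 1) →L[ℝ] Euc d × ℝ) p := by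
    convert hQ' p using 1
    ext1 v
    exact Prod.ext rfl (hL v)
  let Φ₀ := hQ.contDiffAt.toOpenPartialHomeomorph Q hQp (by simp)
  -- The inverse function theorem gives smoothness of the inverse only near the image of p.
  -- Restricting to the open set where the derivative is invertible gives it on the whole target.
  let W : Set (Euc (d + 1)) :=
    fderiv ℝ Q ⁻¹' range ((↑) : (Euc (d + 1) ≃L[ℝ] Euc d × ℝ) → Euc (d + 1) →L[ℝ] Euc d × ℝ)
  have hW : IsOpen W := ContinuousLinearEquiv.isOpen.preimage (hQ.continuous_fderiv (by simp))
  have hΦ : ∀ x, Φ₀.restrOpen W hW x = Q x := fun x => rfl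
  refine ⟨Φ₀.restrOpen W hW, ⟨⟨?_, ?_, ?_⟩, ?_⟩⟩
  · rw [OpenPartialHomeomorph.restrOpen_source]
    exact ⟨hQ.contDiffAt.mem_toOpenPartialHomeomorph_source hQp (by simp), L, hQp.fderiv.symm⟩
  · exact hQ.contDiffOn
  · intro y hy
    have hy' := (Φ₀.restrOpen W hW).map_target hy
    rw [OpenPartialHomeomorph.restrOpen_source] at hy'
    obtain ⟨L', hL'⟩ := hy'.2
    refine (OpenPartialHomeomorph.contDiffAt_symm (f₀' := L') _ hy ?_ hQ.contDiffAt).contDiffWithinAt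
    rw [hL']
    exact ((hQ' _).differentiableAt).hasFDerivAt
  · intro x _
    rw [hM, hΦ]

section Chart

variable {d : ℕ} {M : Set (Euc (d + 1))} {F : Euc (d + 1) → ℝ} {p : Euc (d + 1)}
  {Φ : OpenPartialHomeomorph (Euc (d + 1)) (Euc d × ℝ)}

/-- The inverse of a flattening chart along the hypersurface. -/
def chartParam (Φ : OpenPartialHomeomorph (Euc (d + 1)) (Euc d × ℝ)) (u : Euc d) : Euc (d + 1) :=
  Φ.symm (u, 0)

theorem IsFlatteningChart.mk_zero (hΦ : IsFlatteningChart M p Φ) (hp : p ∈ M) :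
    ((Φ p).1, (0 : ℝ)) = Φ p :=
  Prod.ext rfl ((hΦ.flat p hΦ.mem_source).1 hp).symm

theorem IsFlatteningChart.eventually_mem_target (hΦ : IsFlatteningChart M p Φ) (hp : p ∈ M) :
    ∀ᶠ u in 𝓝 (Φ p).1, ((u, 0) : Euc d × ℝ) ∈ Φ.target := by
  have hc : ContinuousAt (fun u : Euc d => ((u, 0) : Euc d × ℝ)) (Φ p).1 := by fun_prop
  refine hc.eventually (Φ.open_target.mem_nhds ?_)
  change ((Φ p).1, (0 : ℝ)) ∈ Φ.target
  rw [hΦ.mk_zero hp]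
  exact Φ.map_source hΦ.mem_source

theorem IsFlatteningChart.chartParam_mem (hΦ : IsFlatteningChart M p Φ) {u : Euc d}
    (hu : ((u, 0) : Euc d × ℝ) ∈ Φ.target) : chartParam Φ u ∈ M := by
  rw [chartParam, hΦ.flat _ (Φ.map_target hu), Φ.right_inv hu]

theorem IsFlatteningChart.contDiffAt_chartParam (hΦ : IsFlatteningChart M p Φ) {u : Euc d}
    (hu : ((u, 0) : Euc d × ℝ) ∈ Φ.target) : ContDiffAt ℝ ∞ (chartParam Φ) u :=
  (hΦ.contDiffOn_symm.contDiffAt (Φ.open_target.mem_nhds hu)).comp u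
    (contDiff_id.prodMk contDiff_const).contDiffAt

theorem IsFlatteningChart.chartParam_fst (hΦ : IsFlatteningChart M p Φ) (hp : p ∈ M) :
    chartParam Φ (Φ p).1 = p := by
  rw [chartParam, hΦ.mk_zero hp, Φ.left_inv hΦ.mem_source]

theorem IsFlatteningChart.injective_fderiv_chartParam (hΦ : IsFlatteningChart M p Φ) (hp : p ∈ M) :
    Function.Injective (fderiv ℝ (chartParam Φ) (Φ p).1) ∧
    ∀ v, (fderiv ℝ Φ p v).2 = 0 → v ∈ range (fderiv ℝ (chartParam Φ) (Φ p).1) := by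
  obtain ⟨L, hL, hL'⟩ := hΦ.exists_fderiv_equiv hΦ.mem_source
  have hA : fderiv ℝ (chartParam Φ) (Φ p).1 =
      (L.symm : Euc d × ℝ →L[ℝ] Euc (d + 1)).comp (ContinuousLinearMap.inl ℝ (Euc d) ℝ) := by
    rw [← hΦ.mk_zero hp] at hL'
    refine HasFDerivAt.fderiv (hL'.comp (Φ p).1 ?_)
    exact hasFDerivAt_prodMk_left _ _
  rw [hA, hL.fderiv]
  refine ⟨L.symm.injective.comp fun a b h => congrArg Prod.fst h, fun v hv => ⟨(L v).1, ?_⟩⟩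
  change L.symm ((L v).1, 0) = v
  rw [L.symm_apply_eq]
  exact Prod.ext rfl hv.symm

/-- `F` vanishes along the parametrization. The identity is needed at all nearby `u`, not just at
`(Φ p).1`, because `hessian_localExpr` differentiates it again. -/
theorem IsFlatteningChart.fderiv_comp_fderiv_chartParam (hΦ : IsFlatteningChart M p Φ)
    (hF : ContDiff ℝ ∞ F) (hM : ∀ x ∈ M, F x = 0) {u : Euc d}
    (hu : ((u, 0) : Euc d × ℝ) ∈ Φ.target) :
    (fderiv ℝ F (chartParam Φ u)).comp (fderiv ℝ (chartParam Φ) u) = 0 := by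
  have h1 := (hF.differentiable (by simp) (chartParam Φ u)).hasFDerivAt.comp u
    ((hΦ.contDiffAt_chartParam hu).differentiableAt (by simp)).hasFDerivAt
  refine h1.unique ((hasFDerivAt_const (0 : ℝ) u).congr_of_eventuallyEq ?_)
  have hc : ContinuousAt (fun u : Euc d => ((u, 0) : Euc d × ℝ)) u := by fun_prop
  filter_upwards [hc.eventually (Φ.open_target.mem_nhds hu)] with w hw
  exact hM _ (hΦ.chartParam_mem hw)

/-- The range lies in the kernel of dF, and both have dimension d. -/
theorem IsFlatteningChart.range_fderiv_chartParam (hΦ : IsFlatteningChart M p Φ) (hp : p ∈ M)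
    (hF : ContDiff ℝ ∞ F) (hM : ∀ x ∈ M, F x = 0) (hreg : fderiv ℝ F p ≠ 0) (v : Euc (d + 1)) :
    v ∈ range (fderiv ℝ (chartParam Φ) (Φ p).1) ↔ fderiv ℝ F p v = 0 := by
  have h0 := hΦ.fderiv_comp_fderiv_chartParam hF hM (hΦ.eventually_mem_target hp).self_of_nhds
  rw [hΦ.chartParam_fst hp] at h0
  have hle : LinearMap.range (fderiv ℝ (chartParam Φ) (Φ p).1 : Euc d →ₗ[ℝ] Euc (d + 1)) ≤
      LinearMap.ker (fderiv ℝ F p : Euc (d + 1) →ₗ[ℝ] ℝ) := by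
    rintro _ ⟨a, rfl⟩
    exact DFunLike.congr_fun h0 a
  have hsurj : LinearMap.range (fderiv ℝ F p : Euc (d + 1) →ₗ[ℝ] ℝ) = ⊤ := by
    refine LinearMap.range_eq_top.2 fun t => ?_
    obtain ⟨w, hw⟩ := DFunLike.ne_iff.1 hreg
    exact ⟨(t / fderiv ℝ F p w) • w, by
      change fderiv ℝ F p _ = t
      rw [map_smul, smul_eq_mul, div_mul_cancel₀ _ hw]⟩
  have heq := Submodule.eq_of_le_of_finrank_eq hle (by
    have h1 := LinearMap.finrank_range_add_finrank_ker (fderiv ℝ F p : Euc (d + 1) →ₗ[ℝ] ℝ)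
    rw [hsurj, finrank_top, Module.finrank_self, finrank_euclideanSpace_fin] at h1
    rw [LinearMap.finrank_range_of_inj (hΦ.injective_fderiv_chartParam hp).1,
      finrank_euclideanSpace_fin]
    omega)
  exact SetLike.ext_iff.1 heq v

theorem isTangentVector_iff (hp : p ∈ M) (hF : ContDiff ℝ ∞ F) (hM : ∀ x, x ∈ M ↔ F x = 0)
    (hreg : fderiv ℝ F p ≠ 0) {v : Euc (d + 1)} :
    IsTangentVector M p v ↔ fderiv ℝ F p v = 0 := by
  constructor
  · rintro ⟨Φ, hΦ, hv⟩
    rw [← hΦ.range_fderiv_chartParam hp hF (fun x => (hM x).1) hreg]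
    exact (hΦ.injective_fderiv_chartParam hp).2 v hv
  · intro hv
    obtain ⟨Φ, hΦ⟩ := exists_isFlatteningChart hF hM hreg
    refine ⟨Φ, hΦ, ?_⟩
    obtain ⟨a, rfl⟩ := (hΦ.range_fderiv_chartParam hp hF (fun x => (hM x).1) hreg v).2 hv
    obtain ⟨L, hL, hL'⟩ := hΦ.exists_fderiv_equiv hΦ.mem_source
    rw [← hΦ.mk_zero hp] at hL'
    have hA : fderiv ℝ (chartParam Φ) (Φ p).1 =
        (L.symm : Euc d × ℝ →L[ℝ] Euc (d + 1)).comp (ContinuousLinearMap.inl ℝ (Euc d) ℝ) :=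
      HasFDerivAt.fderiv (hL'.comp (Φ p).1 (hasFDerivAt_prodMk_left _ _))
    rw [hA, hL.fderiv]
    simp

/-! ### Critical points and Hessians of linear functions on regular zero sets. -/

variable (l : Euc (d + 1) →L[ℝ] ℝ)

theorem IsFlatteningChart.fderiv_localExpr (hΦ : IsFlatteningChart M p Φ) {u : Euc d}
    (hu : ((u, 0) : Euc d × ℝ) ∈ Φ.target) :
    fderiv ℝ (localExpr l Φ) u = l.comp (fderiv ℝ (chartParam Φ) u) :=
  (l.hasFDerivAt.comp u
    ((hΦ.contDiffAt_chartParam hu).differentiableAt (by simp)).hasFDerivAt).fderiv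

/-- A linear function is critical on a regular zero set at the points where it vanishes on the
tangent space. -/
theorem mem_criticalSet_iff (hF : ContDiff ℝ ∞ F) (hM : ∀ x, x ∈ M ↔ F x = 0)
    (hreg : ∀ x ∈ M, fderiv ℝ F x ≠ 0) :
    p ∈ criticalSet l M ↔ p ∈ M ∧ ∀ v, fderiv ℝ F p v = 0 → l v = 0 := by
  refine and_congr_right fun hp => ?_
  -- The criterion is the same in every chart, so the existential over charts in `criticalSet` is
  -- harmless.
  have key : ∀ Φ, IsFlatteningChart M p Φ → (fderiv ℝ (localExpr l Φ) (Φ p).1 = 0 ↔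
      ∀ v, fderiv ℝ F p v = 0 → l v = 0) := fun Φ hΦ => by
    rw [hΦ.fderiv_localExpr l (hΦ.eventually_mem_target hp).self_of_nhds]
    constructor
    · intro h v hv
      obtain ⟨a, rfl⟩ := (hΦ.range_fderiv_chartParam hp hF (fun x => (hM x).1) (hreg p hp) v).2 hv
      exact DFunLike.congr_fun h a
    · intro h
      ext1 a
      exact h _ ((hΦ.range_fderiv_chartParam hp hF (fun x => (hM x).1) (hreg p hp) _).1 ⟨a, rfl⟩)
  constructor
  · rintro ⟨Φ, hΦ, h⟩
    exact (key Φ hΦ).1 h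
  · intro h
    obtain ⟨Φ, hΦ⟩ := exists_isFlatteningChart hF hM (hreg p hp)
    exact ⟨Φ, hΦ, (key Φ hΦ).2 h⟩

variable {l}

/-- At a critical point, the Hessian of a linear function in a flattening chart is the restriction
of the Hessian of a defining function to the tangent space, up to a Lagrange multiplier. -/
theorem IsFlatteningChart.hessian_localExpr (hΦ : IsFlatteningChart M p Φ) (hp : p ∈ M)
    (hF : ContDiff ℝ ∞ F) (hM : ∀ x ∈ M, F x = 0) {c : ℝ} (hl : l = c • fderiv ℝ F p)
    (a b : Euc d) :
    fderiv ℝ (fderiv ℝ (localExpr l Φ)) (Φ p).1 a b =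
      -(c * fderiv ℝ (fderiv ℝ F) p (fderiv ℝ (chartParam Φ) (Φ p).1 a)
        (fderiv ℝ (chartParam Φ) (Φ p).1 b)) := by
  have hu := (hΦ.eventually_mem_target hp).self_of_nhds
  have hev := hΦ.eventually_mem_target hp
  have hφ := hΦ.contDiffAt_chartParam hu
  have hφ1 : HasFDerivAt (chartParam Φ) (fderiv ℝ (chartParam Φ) (Φ p).1) (Φ p).1 :=
    (hφ.differentiableAt (by simp)).hasFDerivAt
  have hφ2 : HasFDerivAt (fderiv ℝ (chartParam Φ))
      (fderiv ℝ (fderiv ℝ (chartParam Φ)) (Φ p).1) (Φ p).1 :=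
    ((hφ.fderiv_right (m := 1) (by norm_cast)).differentiableAt (by simp)).hasFDerivAt
  have hF2 : HasFDerivAt (fderiv ℝ F) (fderiv ℝ (fderiv ℝ F) p) (chartParam Φ (Φ p).1) := by
    rw [hΦ.chartParam_fst hp]
    exact ((hF.fderiv_right (m := 1) (by norm_cast)).differentiable (by simp) p).hasFDerivAt
  have h1 := ((hasFDerivAt_const l (Φ p).1).clm_comp hφ2).congr_of_eventuallyEq
    (hev.mono fun u hu => hΦ.fderiv_localExpr l hu)
  -- With φ the parametrization, differentiating dF ∘ dφ = 0 gives d²F(dφ a, dφ b) + dF(d²φ(a, b)) =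
  -- 0. Multiplying by c turns the second term into l(d²φ(a, b)), the Hessian sought.
  have h2 := ((hF2.comp (Φ p).1 hφ1).clm_comp hφ2).unique
    ((hasFDerivAt_const (0 : Euc d →L[ℝ] ℝ) (Φ p).1).congr_of_eventuallyEq
      (hev.mono fun u hu => hΦ.fderiv_comp_fderiv_chartParam hF hM hu))
  have h3 := DFunLike.congr_fun (DFunLike.congr_fun h2 a) b
  rw [h1.fderiv]
  simp only [Function.comp_apply, hΦ.chartParam_fst hp] at h3
  simp at h3
  simp [hl]
  linear_combination c * h3

theorem exists_eq_smul_of_ker_le {E : Type*} [NormedAddCommGroup E] [NormedSpace ℝ E]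
    {l m : E →L[ℝ] ℝ} (hm : m ≠ 0) (h : ∀ v, m v = 0 → l v = 0) : ∃ c : ℝ, l = c • m := by
  obtain ⟨w, hw⟩ := DFunLike.ne_iff.1 hm
  have hw' : m w ≠ 0 := hw
  refine ⟨l w / m w, ?_⟩
  ext1 v
  have h1 := h (v - (m v / m w) • w) (by simp [hw'])
  simp only [map_sub, map_smul, smul_eq_mul] at h1
  simp only [smul_apply, smul_eq_mul]
  linear_combination h1

/-- The multiplier c is nonzero because `l` is, so the Hessian in the chart and d²F on the tangent
space have the same degeneracies. -/
theorem IsFlatteningChart.nondegenerate_iff (hΦ : IsFlatteningChart M p Φ) (hp : p ∈ M)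
    (hF : ContDiff ℝ ∞ F) (hM : ∀ x ∈ M, F x = 0) (hreg : fderiv ℝ F p ≠ 0) (hl : l ≠ 0)
    (hcrit : ∀ v, fderiv ℝ F p v = 0 → l v = 0) :
    (∀ a, fderiv ℝ (fderiv ℝ (localExpr l Φ)) (Φ p).1 a = 0 → a = 0) ↔
      ∀ v, fderiv ℝ F p v = 0 →
        (∀ w, fderiv ℝ F p w = 0 → fderiv ℝ (fderiv ℝ F) p v w = 0) → v = 0 := by
  obtain ⟨c, hc⟩ := exists_eq_smul_of_ker_le hreg hcrit
  have hc0 : c ≠ 0 := by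
    rintro rfl
    exact hl (by rw [hc, zero_smul])
  have hH := hΦ.hessian_localExpr hp hF hM hc
  have hr := hΦ.range_fderiv_chartParam hp hF hM hreg
  constructor
  · intro h v hv hvw
    obtain ⟨a, rfl⟩ := (hr v).2 hv
    rw [h a, map_zero]
    ext1 b
    rw [hH, hvw _ ((hr _).1 ⟨b, rfl⟩)]
    simp
  · intro h a ha
    refine (hΦ.injective_fderiv_chartParam hp).1 ?_
    rw [map_zero]
    refine h _ ((hr _).1 ⟨a, rfl⟩) fun w hw => ?_
    obtain ⟨b, rfl⟩ := (hr w).2 hw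
    have h1 := hH a b
    rw [ha] at h1
    simpa [hc0] using h1

/-- Morse functions on regular zero sets, in terms of a defining function. -/
theorem isMorseOn_iff (hF : ContDiff ℝ ∞ F) (hM : ∀ x, x ∈ M ↔ F x = 0)
    (hreg : ∀ x ∈ M, fderiv ℝ F x ≠ 0) (hl : l ≠ 0) :
    IsMorseOn l M ↔ ∀ p ∈ M, (∀ v, fderiv ℝ F p v = 0 → l v = 0) → ∀ v, fderiv ℝ F p v = 0 →
      (∀ w, fderiv ℝ F p w = 0 → fderiv ℝ (fderiv ℝ F) p v w = 0) → v = 0 := by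
  constructor
  · rintro ⟨-, h⟩ p hp hcrit
    obtain ⟨Φ, hΦ, h'⟩ := h p ((mem_criticalSet_iff l hF hM hreg).2 ⟨hp, hcrit⟩)
    exact (hΦ.nondegenerate_iff hp hF (fun x => (hM x).1) (hreg p hp) hl hcrit).1 h'
  · refine fun h => ⟨l.contDiff, fun p hp => ?_⟩
    obtain ⟨hp, hcrit⟩ := (mem_criticalSet_iff l hF hM hreg).1 hp
    obtain ⟨Φ, hΦ⟩ := exists_isFlatteningChart hF hM (hreg p hp)
    exact ⟨Φ, hΦ, (hΦ.nondegenerate_iff hp hF (fun x => (hM x).1) (hreg p hp) hl hcrit).2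
      (h p hp hcrit)⟩

end Chart

/-! ### Existence of a global regular defining function -/

/-- The function `g` is a regular defining function of `D` on the open set `U`. -/
structure IsLocalDefiningFunction {m : ℕ} (D U : Set (Euc m)) (g : Euc m → ℝ) : Prop where
  isOpen : IsOpen U
  contDiffOn : ContDiffOn ℝ ∞ g U
  mem_iff : ∀ x ∈ U, x ∈ D ↔ 0 ≤ g x
  frontier_iff : ∀ x ∈ U, x ∈ frontier D ↔ g x = 0
  regular : ∀ x ∈ U, x ∈ frontier D → fderiv ℝ g x ≠ 0

/-- A zero of `g` in the interior of `D` would be a local minimum, contradicting regularity; a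
positive value forces an interior point by continuity. -/
theorem isLocalDefiningFunction_of_regular {m : ℕ} {D U : Set (Euc m)} {g : Euc m → ℝ}
    (hD : IsClosed D) (hU : IsOpen U) (hg : ContDiffOn ℝ ∞ g U)
    (hmem : ∀ x ∈ U, x ∈ D ↔ 0 ≤ g x) (hreg : ∀ x ∈ U, fderiv ℝ g x ≠ 0) :
    IsLocalDefiningFunction D U g := by
  refine ⟨hU, hg, hmem, fun x hx => ?_, fun x hx _ => hreg x hx⟩
  have hc : ContinuousAt g x := (hg.continuousOn.continuousAt (hU.mem_nhds hx))
  rw [hD.frontier_eq]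
  constructor
  · rintro ⟨hxD, hxi⟩
    refine le_antisymm (not_lt.1 fun hpos => hxi ?_) ((hmem x hx).1 hxD)
    rw [mem_interior_iff_mem_nhds]
    filter_upwards [hU.mem_nhds hx, hc.eventually (lt_mem_nhds hpos)] with y hy hy'
    exact (hmem y hy).2 hy'.le
  · refine fun h0 => ⟨(hmem x hx).2 h0.ge, fun hi => hreg x hx ?_⟩
    refine IsLocalMin.fderiv_eq_zero ?_
    filter_upwards [hU.mem_nhds hx, mem_interior_iff_mem_nhds.1 hi] with y hy hyD
    rw [h0]
    exact (hmem y hy).1 hyD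

/-- The last chart coordinate serves at frontier points, the constant 1 on the interior and -1 on
the complement. -/
theorem IsSmoothDomain.exists_isLocalDefiningFunction {d : ℕ} {D : Set (Euc (d + 1))}
    (hD : IsSmoothDomain D) (p : Euc (d + 1)) :
    ∃ U g, p ∈ U ∧ IsLocalDefiningFunction D U g := by
  by_cases hp : p ∈ frontier D
  · obtain ⟨Φ, hΦ, hmem⟩ := hD.2 p hp
    refine ⟨Φ.source, fun x => (Φ x).2, hΦ.mem_source,
      isLocalDefiningFunction_of_regular hD.1 Φ.open_source
        (contDiff_snd.comp_contDiffOn hΦ.contDiffOn) hmem fun x hx h0 => ?_⟩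
    obtain ⟨L, hL, -⟩ := hΦ.exists_fderiv_equiv hx
    have h := (hasFDerivAt_snd.comp x hL).fderiv
    have h' : fderiv ℝ (fun x => (Φ x).2) x (L.symm (0, 1)) = 1 := by
      change fderiv ℝ (Prod.snd ∘ Φ) x _ = 1
      rw [h]; simp
    rw [h0] at h'
    simp at h'
  · by_cases hpD : p ∈ D
    · refine ⟨interior D, fun _ => 1, ?_, isOpen_interior, contDiffOn_const, ?_, ?_, ?_⟩
      · by_contra h
        exact hp (hD.1.frontier_eq ▸ ⟨hpD, h⟩)
      · exact fun x hx => ⟨fun _ => zero_le_one, fun _ => interior_subset hx⟩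
      · exact fun x hx => ⟨fun h => absurd hx h.2, fun h => absurd h one_ne_zero⟩
      · exact fun x hx h => absurd hx h.2
    · refine ⟨Dᶜ, fun _ => -1, hpD, hD.1.isOpen_compl, contDiffOn_const, ?_, ?_, ?_⟩
      · exact fun x hx => ⟨fun h => absurd h hx, fun h => by norm_num at h⟩
      · exact fun x hx => ⟨fun h => absurd (hD.1.frontier_subset h) hx, fun h => by norm_num at h⟩
      · exact fun x hx h => absurd (hD.1.frontier_subset h) hx

theorem fderiv_eq_zero_of_abs_le {E : Type*} [NormedAddCommGroup E] [NormedSpace ℝ E]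
    {h k : E → ℝ} {x : E} (hk : ∀ y, |k y| ≤ |h y|) (hx : h x = 0) (hh : DifferentiableAt ℝ h x)
    (h0 : fderiv ℝ h x = 0) : fderiv ℝ k x = 0 := by
  have hkx : k x = 0 := by simpa [hx] using hk x
  have h1 := hh.hasFDerivAt
  rw [h0, hasFDerivAt_iff_isLittleO] at h1
  refine HasFDerivAt.fderiv ?_
  rw [hasFDerivAt_iff_isLittleO]
  refine Asymptotics.IsBigO.trans_isLittleO (Asymptotics.IsBigO.of_bound 1 ?_) h1
  filter_upwards with y
  simpa [hx, hkx] using hk y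

/-- At each point all summands ρᵢgᵢ have the same sign, so each is dominated by |h|. This yields the
zero set of h, and also regularity: if dh vanished at a frontier point, so would every d(ρᵢgᵢ). -/
theorem IsSmoothDomain.exists_isDefiningFunction {d : ℕ} {D : Set (Euc (d + 1))}
    (hD : IsSmoothDomain D) : ∃ h : Euc (d + 1) → ℝ, IsDefiningFunction D h := by
  choose U g hpU hg using hD.exists_isLocalDefiningFunction
  obtain ⟨ρ, hρ⟩ := SmoothPartitionOfUnity.exists_isSubordinate
    (modelWithCornersSelf ℝ (Euc (d + 1))) isClosed_univ U (fun i => (hg i).isOpen)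
    (fun x _ => mem_iUnion.2 ⟨x, hpU x⟩)
  have hρU : ∀ i x, ρ i x ≠ 0 → x ∈ U i := fun i x h => hρ i (subset_tsupport _ h)
  set h : Euc (d + 1) → ℝ := fun x => ∑ᶠ i, ρ i x • g i x with hdef
  have hsmooth : ContDiff ℝ ∞ h := by
    rw [← contMDiff_iff_contDiff]
    refine ρ.contMDiff_finsum_smul fun i x hx => ContDiffAt.contMDiffAt ?_
    exact (hg i).contDiffOn.contDiffAt ((hg i).isOpen.mem_nhds (hρ i hx))
  have hfin : ∀ x, (Function.support fun i => ρ i x • g i x).Finite := fun x =>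
    (ρ.locallyFinite.point_finite x).subset fun i hi => by
      simp only [Function.mem_support, smul_eq_mul, ne_eq, mul_eq_zero, not_or] at hi
      exact hi.1
  have hin : ∀ x ∈ D, ∀ i, 0 ≤ ρ i x • g i x := fun x hx i => by
    by_cases h0 : ρ i x = 0
    · simp [h0]
    · exact mul_nonneg (ρ.nonneg i x) (((hg i).mem_iff x (hρU i x h0)).1 hx)
  have hout : ∀ x ∉ D, ∀ i, ρ i x • g i x ≤ 0 := fun x hx i => by
    by_cases h0 : ρ i x = 0
    · simp [h0]
    · refine mul_nonpos_of_nonneg_of_nonpos (ρ.nonneg i x) (le_of_lt ?_)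
      exact not_le.1 (mt ((hg i).mem_iff x (hρU i x h0)).2 hx)
  have habs : ∀ i x, |ρ i x • g i x| ≤ |h x| := fun i x => by
    by_cases hx : x ∈ D
    · have h1 := single_le_finsum i (f := fun i => ρ i x • g i x) (hfin x) (hin x hx)
      rw [abs_of_nonneg (hin x hx i)]
      exact h1.trans (le_abs_self _)
    · have h1 := single_le_finsum i (f := fun i => -(ρ i x • g i x))
        (by simpa [Function.HasFiniteSupport, Function.support_neg] using hfin x)
        (fun j => neg_nonneg.2 (hout x hx j))
      rw [finsum_neg_distrib] at h1
      rw [abs_of_nonpos (hout x hx i)]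
      exact h1.trans (neg_le_abs _)
  have hpos : ∀ x, ∃ i, 0 < ρ i x := fun x => ρ.exists_pos_of_mem (mem_univ x)
  have hfr : ∀ x, x ∈ frontier D ↔ h x = 0 := fun x => by
    constructor
    · intro hx
      refine finsum_eq_zero_of_forall_eq_zero fun i => ?_
      by_cases h0 : ρ i x = 0
      · simp [h0]
      · simp [((hg i).frontier_iff x (hρU i x h0)).1 hx]
    · intro hx
      obtain ⟨i, hi⟩ := hpos x
      have h1 := habs i x
      rw [hx, abs_zero, abs_nonpos_iff, smul_eq_mul, mul_eq_zero, or_iff_right hi.ne'] at h1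
      exact ((hg i).frontier_iff x (hρU i x hi.ne')).2 h1
  refine ⟨h, hsmooth, ?_, ?_, ?_⟩
  · ext x
    refine ⟨fun hx => finsum_nonneg (hin x hx), fun hx => ?_⟩
    by_contra hxD
    have h1 : h x ≤ 0 := by
      have := finsum_nonneg (f := fun i => -(ρ i x • g i x))
        (fun j => neg_nonneg.2 (hout x hxD j))
      rw [finsum_neg_distrib] at this
      exact neg_nonneg.1 this
    exact hxD (hD.1.frontier_subset ((hfr x).2 (le_antisymm h1 hx)))
  · ext x
    exact hfr x
  · intro x hx h0
    obtain ⟨i, hi⟩ := hpos x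
    have hxU := hρU i x hi.ne'
    have hk := fderiv_eq_zero_of_abs_le (k := fun y => ρ i y • g i y) (habs i) ((hfr x).1 hx)
      (hsmooth.differentiable (by simp) x) h0
    have hgd : DifferentiableAt ℝ (g i) x :=
      ((hg i).contDiffOn.contDiffAt ((hg i).isOpen.mem_nhds hxU)).differentiableAt (by simp)
    have hρd : DifferentiableAt ℝ (ρ i) x :=
      ((ρ i).contMDiff.contDiff.differentiable (by simp)) x
    have hd := (hρd.hasFDerivAt.smul hgd.hasFDerivAt).fderiv
    have hg0 := ((hg i).frontier_iff x hxU).1 hx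
    -- Since gᵢ(x) = 0, the product rule reduces d(ρᵢgᵢ) to ρᵢ(x) dgᵢ, with ρᵢ(x) > 0.
    refine (hg i).regular x hxU hx ?_
    change fderiv ℝ (⇑(ρ i) • g i) x = 0 at hk
    rw [hd, hg0] at hk
    ext v
    have := DFunLike.congr_fun hk v
    simpa [hi.ne'] using this

/-! ### The double of a domain -/

/-- The splitting `ℝ^(m+1) = ℝ^m × ℝ`. -/
def splitLast (m : ℕ) : Euc (m + 1) ≃L[ℝ] Euc m × ℝ :=
  LinearEquiv.toContinuousLinearEquiv
    { toFun := fun p => (dropLast p, p (Fin.last m))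
      map_add' := fun _ _ => rfl
      map_smul' := fun _ _ => rfl
      invFun := fun q => WithLp.toLp 2 (Fin.snoc (α := fun _ => ℝ) q.1 q.2)
      left_inv := fun p => by
        ext i
        refine Fin.lastCases ?_ (fun j => ?_) i <;> simp [dropLast]
      right_inv := fun q => by
        refine Prod.ext ?_ (by simp)
        ext i
        simp [dropLast] }

theorem dropLast_splitLast_symm {m : ℕ} (q : Euc m × ℝ) :
    dropLast ((splitLast m).symm q) = q.1 :=
  congrArg Prod.fst ((splitLast m).apply_symm_apply q)

theorem splitLast_symm_last {m : ℕ} (q : Euc m × ℝ) :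
    (splitLast m).symm q (Fin.last m) = q.2 :=
  congrArg Prod.snd ((splitLast m).apply_symm_apply q)

/-- The projection `ℝ^(m+1) → ℝ^m` as a continuous linear map. -/
def dropLastCLM (m : ℕ) : Euc (m + 1) →L[ℝ] Euc m :=
  (ContinuousLinearMap.fst ℝ (Euc m) ℝ).comp (splitLast m : Euc (m + 1) →L[ℝ] Euc m × ℝ)

/-- The last coordinate as a continuous linear map. -/
def lastCLM (m : ℕ) : Euc (m + 1) →L[ℝ] ℝ :=
  (ContinuousLinearMap.snd ℝ (Euc m) ℝ).comp (splitLast m : Euc (m + 1) →L[ℝ] Euc m × ℝ)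

/-- The first coordinate as a continuous linear map. -/
def firstCLM (d : ℕ) : Euc (d + 1) →L[ℝ] ℝ := EuclideanSpace.proj 0

theorem firstCLM_ne_zero (d : ℕ) : firstCLM d ≠ 0 := fun h => by
  have := DFunLike.congr_fun h (EuclideanSpace.single 0 1)
  simp [firstCLM] at this

theorem coe_firstCLM (d : ℕ) : ⇑(firstCLM d) = firstCoord d := rfl

/-- The function `y² - h x`, of which the double is the zero set. -/
def doubleFun {m : ℕ} (h : Euc m → ℝ) (p : Euc (m + 1)) : ℝ :=
  lastCLM m p ^ 2 - h (dropLastCLM m p)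

theorem mem_doubleHypersurface_iff {m : ℕ} {h : Euc m → ℝ} (p : Euc (m + 1)) :
    p ∈ doubleHypersurface h ↔ doubleFun h p = 0 := sub_eq_zero.symm

section Double

variable {m : ℕ} {h : Euc m → ℝ}

theorem contDiff_doubleFun (hh : ContDiff ℝ ∞ h) : ContDiff ℝ ∞ (doubleFun h) :=
  ((lastCLM m).contDiff.pow 2).sub (hh.comp (dropLastCLM m).contDiff)

theorem fderiv_doubleFun (hh : ContDiff ℝ ∞ h) (p : Euc (m + 1)) :
    fderiv ℝ (doubleFun h) p =
      (2 * lastCLM m p) • lastCLM m - (fderiv ℝ h (dropLastCLM m p)).comp (dropLastCLM m) := by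
  have h1 := ((lastCLM m).hasFDerivAt (x := p)).pow 2
  have h2 := (hh.differentiable (by simp) (dropLastCLM m p)).hasFDerivAt.comp p
    (dropLastCLM m).hasFDerivAt
  refine (HasFDerivAt.fderiv (h1.sub h2)).trans ?_
  ext v
  simp

theorem fderiv_fderiv_doubleFun (hh : ContDiff ℝ ∞ h) (p v w : Euc (m + 1)) :
    fderiv ℝ (fderiv ℝ (doubleFun h)) p v w = 2 * lastCLM m v * lastCLM m w -
      fderiv ℝ (fderiv ℝ h) (dropLastCLM m p) (dropLastCLM m v) (dropLastCLM m w) := by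
  rw [funext (fderiv_doubleFun hh)]
  have h1 := (((lastCLM m).hasFDerivAt (x := p)).const_mul 2).smul_const (lastCLM m)
  have h2 := (((hh.fderiv_right (m := 1) (by norm_cast)).differentiable (by simp)
    (dropLastCLM m p)).hasFDerivAt.comp p (dropLastCLM m).hasFDerivAt).clm_comp
      (hasFDerivAt_const (dropLastCLM m) p)
  have h3 := (h1.sub h2).fderiv
  refine (congrArg (fun L => L v w) h3).trans ?_
  simp

theorem fderiv_doubleFun_splitLast_symm (hh : ContDiff ℝ ∞ h) (p : Euc (m + 1)) (v : Euc m)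
    (t : ℝ) : fderiv ℝ (doubleFun h) p ((splitLast m).symm (v, t)) =
      2 * p (Fin.last m) * t - fderiv ℝ h (dropLast p) v := by
  rw [fderiv_doubleFun hh]
  change 2 * p (Fin.last m) * (splitLast m).symm (v, t) (Fin.last m) -
    fderiv ℝ h (dropLast p) (dropLast ((splitLast m).symm (v, t))) = _
  rw [dropLast_splitLast_symm, splitLast_symm_last]

variable {D : Set (Euc m)}

theorem IsDefiningFunction.mem_iff (H : IsDefiningFunction D h) (x : Euc m) : x ∈ D ↔ 0 ≤ h x :=
  Set.ext_iff.1 H.eq_nonneg x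

theorem IsDefiningFunction.mem_frontier_iff (H : IsDefiningFunction D h) (x : Euc m) :
    x ∈ frontier D ↔ h x = 0 :=
  Set.ext_iff.1 H.frontier_eq x

theorem IsDefiningFunction.dropLast_mem_frontier (H : IsDefiningFunction D h) {p : Euc (m + 1)}
    (hp : p ∈ doubleHypersurface h) (h0 : p (Fin.last m) = 0) : dropLast p ∈ frontier D := by
  have hp' : p (Fin.last m) ^ 2 = h (dropLast p) := hp
  rw [H.mem_frontier_iff, ← hp', h0]
  simp

/-- The vertical derivative 2y vanishes only at y = 0; there the point lies over ∂D, where dh ≠ 0.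
-/
theorem IsDefiningFunction.regular_double (H : IsDefiningFunction D h) (p : Euc (m + 1))
    (hp : p ∈ doubleHypersurface h) : fderiv ℝ (doubleFun h) p ≠ 0 := by
  intro h0
  have key : ∀ v t, 2 * p (Fin.last m) * t - fderiv ℝ h (dropLast p) v = 0 := fun v t => by
    rw [← fderiv_doubleFun_splitLast_symm H.contDiff, h0]
    rfl
  have hl : p (Fin.last m) = 0 := by simpa using key 0 1
  refine H.regular _ (H.dropLast_mem_frontier hp hl) ?_
  ext v
  simpa using key v 0

theorem isClosed_doubleHypersurface (hh : ContDiff ℝ ∞ h) : IsClosed (doubleHypersurface h) := by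
  have : doubleHypersurface h = doubleFun h ⁻¹' {0} := by
    ext p
    exact mem_doubleHypersurface_iff p
  rw [this]
  exact isClosed_singleton.preimage (contDiff_doubleFun hh).continuous

/-- On the compact closure of `C` the function h is bounded by some b, hence |y| ≤ √b over `C`. -/
theorem IsDefiningFunction.isBounded_double (H : IsDefiningFunction D h) {C : Set (Euc m)}
    (hC : Bornology.IsBounded C) :
    Bornology.IsBounded (doubleHypersurface h ∩ dropLast ⁻¹' C) := by
  obtain ⟨b, hb⟩ := (hC.isCompact_closure.image H.contDiff.continuous).bddAbove
  have hbd : Bornology.IsBounded ((splitLast m).symm '' (C ×ˢ Icc (-√b) √b)) :=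
    (splitLast m).symm.lipschitz.isBounded_image (hC.prod (Metric.isBounded_Icc _ _))
  refine hbd.subset fun p hp => ⟨splitLast m p, ⟨hp.2, ?_⟩, (splitLast m).symm_apply_apply p⟩
  have h1 : p (Fin.last m) ^ 2 = h (dropLast p) := hp.1
  refine abs_le.1 (Real.abs_le_sqrt ?_)
  change p (Fin.last m) ^ 2 ≤ b
  rw [h1]
  exact hb ⟨_, subset_closure hp.2, rfl⟩

/-- The section of the projection of the double whose last coordinate is nonnegative. -/
def doubleSection (h : Euc m → ℝ) (x : Euc m) : Euc (m + 1) := (splitLast m).symm (x, √(h x))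

end Double

/-! ### Level components of the domain, and the geometry of its double. -/

section Level

variable {d : ℕ} {D : Set (Euc (d + 1))}

theorem IsDomainOfFiniteType.isBounded_level (hD : IsDomainOfFiniteType D) (t : ℝ) :
    Bornology.IsBounded (D ∩ firstCoord d ⁻¹' {t}) := by
  have h := (hD.proper.isCompact_preimage (isCompact_singleton (x := t))).image
    continuous_subtype_val
  refine h.isBounded.subset fun x hx => ⟨⟨x, hx.1⟩, hx.2, rfl⟩

/-- Every component of a level set meets the boundary: leave it along a ray. -/
theorem IsDomainOfFiniteType.exists_mem_frontier (hD : IsDomainOfFiniteType D) (hd : 1 ≤ d)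
    {x : Euc (d + 1)} (hx : x ∈ D) :
    ∃ z ∈ connectedComponentIn (D ∩ firstCoord d ⁻¹' {firstCoord d x}) x, z ∈ frontier D := by
  obtain ⟨R, hR⟩ := (hD.isBounded_level (firstCoord d x)).exists_norm_le
  -- A coordinate direction other than the first, along which the level set is not left; it exists
  -- because d ≥ 1.
  let i : Fin (d + 1) := ⟨1, by omega⟩
  have hi : (0 : Fin (d + 1)) ≠ i := fun h => by simpa [i] using congrArg Fin.val h
  let γ : ℝ → Euc (d + 1) := fun s => x + s • EuclideanSpace.single i 1
  have hγ : Continuous γ := by fun_prop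
  have hγ0 : γ 0 = x := by simp [γ]
  have hγf : ∀ s, firstCoord d (γ s) = firstCoord d x := fun s => by
    simp [γ, firstCoord, hi]
  have hR0 : 0 ≤ R := (norm_nonneg x).trans (hR x ⟨hx, rfl⟩)
  have hcross : ∀ s, 0 ≤ s → γ s ∉ D → ∃ r, 0 ≤ r ∧ r ≤ s ∧ γ r ∈ frontier D := by
    intro s hs hsD
    have hpre : IsPreconnected (γ '' Icc 0 s) := isPreconnected_Icc.image _ hγ.continuousOn
    by_contra! hno
    have hsub := hpre.subset_or_subset (u := interior D) (v := Dᶜ) isOpen_interior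
      hD.smooth.1.isOpen_compl (disjoint_compl_right.mono_left interior_subset) (by
        rintro _ ⟨r, hr, rfl⟩
        by_cases hrD : γ r ∈ D
        · left
          by_contra hri
          exact hno r hr.1 hr.2 (hD.smooth.1.frontier_eq ▸ ⟨hrD, hri⟩)
        · exact Or.inr hrD)
    rcases hsub with h | h
    · exact hsD (interior_subset (h ⟨s, ⟨hs, le_rfl⟩, rfl⟩))
    · exact h ⟨0, ⟨le_rfl, hs⟩, rfl⟩ (hγ0 ▸ hx)
  -- Two points of the slice of `D` are at distance at most 2R.
  have hout : γ (2 * R + 1) ∉ D := by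
    intro hmem
    have h1 := hR _ ⟨hmem, hγf _⟩
    have h2 := hR x ⟨hx, rfl⟩
    have h3 : ‖(2 * R + 1) • (EuclideanSpace.single i (1 : ℝ) : Euc (d + 1))‖ = 2 * R + 1 := by
      rw [norm_smul, PiLp.norm_single, norm_one, mul_one, Real.norm_of_nonneg]
      linarith
    have h4 := norm_sub_le (γ (2 * R + 1)) x
    simp only [γ, add_sub_cancel_left] at h4 h1
    linarith
  -- Its infimum is the first time the ray meets the frontier. Up to then the ray stays in `D`,
  -- since leaving would need an earlier crossing.
  let A : Set ℝ := {s | 0 ≤ s ∧ γ s ∈ frontier D}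
  have hA : IsClosed A :=
    (isClosed_Ici (a := (0 : ℝ))).inter (isClosed_frontier.preimage hγ)
  have hAb : BddBelow A := ⟨0, fun s hs => hs.1⟩
  have hAn : A.Nonempty := by
    obtain ⟨r, h1, -, h2⟩ := hcross _ (by linarith) hout
    exact ⟨r, h1, h2⟩
  have hmin := hA.csInf_mem hAn hAb
  refine ⟨γ (sInf A), ?_, hmin.2⟩
  refine (isPreconnected_Icc.image γ hγ.continuousOn).subset_connectedComponentIn
    (s := γ '' Icc 0 (sInf A)) ⟨0, ⟨le_rfl, hmin.1⟩, hγ0⟩ ?_ ⟨_, ⟨hmin.1, le_rfl⟩, rfl⟩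
  rintro _ ⟨s, hs, rfl⟩
  refine ⟨?_, hγf s⟩
  by_contra hsD
  obtain ⟨r, h1, h2, h3⟩ := hcross s hs.1 hsD
  have h4 : r = s := le_antisymm h2 (hs.2.trans (csInf_le hAb ⟨h1, h3⟩))
  exact hsD (hD.smooth.1.frontier_subset (h4 ▸ h3))

variable {h : Euc (d + 1) → ℝ}

/-- For `section_mem`, the level component C of `dropLast y` is lifted to the two sheets ±√h. They
meet over a frontier point of C, so their union is connected; it contains both y and the section
point. -/
theorem IsDomainOfFiniteType.isReebProjection (hD : IsDomainOfFiniteType D) (hd : 1 ≤ d)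
    (H : IsDefiningFunction D h) :
    IsReebProjection D (firstCoord d) (doubleHypersurface h) (firstCoord (d + 1))
      dropLast (doubleSection h) where
  continuous_proj := (dropLastCLM (d + 1)).continuous
  continuous_section := (splitLast (d + 1)).symm.continuous.comp
    (continuous_id.prodMk (Real.continuous_sqrt.comp H.contDiff.continuous))
  mapsTo_proj p hp := by
    have h1 : p (Fin.last (d + 1)) ^ 2 = h (dropLast p) := hp
    rw [H.mem_iff, ← h1]
    positivity
  mapsTo_section x hx := by
    change (splitLast (d + 1)).symm (x, √(h x)) (Fin.last _) ^ 2 =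
      h (dropLast ((splitLast (d + 1)).symm (x, √(h x))))
    rw [splitLast_symm_last, dropLast_splitLast_symm, Real.sq_sqrt ((H.mem_iff x).1 hx)]
  proj_section x := dropLast_splitLast_symm _
  height y := rfl
  section_mem y hy := by
    have h1 : y (Fin.last (d + 1)) ^ 2 = h (dropLast y) := hy
    have hx : dropLast y ∈ D := by
      rw [H.mem_iff, ← h1]
      positivity
    obtain ⟨z, hzC, hz⟩ := hD.exists_mem_frontier hd hx
    set C := connectedComponentIn (D ∩ firstCoord d ⁻¹' {firstCoord d (dropLast y)}) (dropLast y)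
    have hxC : dropLast y ∈ C := mem_connectedComponentIn ⟨hx, rfl⟩
    have hCD : C ⊆ _ := connectedComponentIn_subset _ _
    let σ : ℝ → Euc (d + 1) → Euc (d + 2) := fun c x => (splitLast (d + 1)).symm (x, c * √(h x))
    have hσ : ∀ c, Continuous (σ c) := fun c => (splitLast (d + 1)).symm.continuous.comp
      (continuous_id.prodMk
        (continuous_const.mul (Real.continuous_sqrt.comp H.contDiff.continuous)))
    have hpre : ∀ c, IsPreconnected (σ c '' C) := fun c =>
      isPreconnected_connectedComponentIn.image _ (hσ c).continuousOn
    have hz0 : σ (-1) z = σ 1 z := by simp [σ, (H.mem_frontier_iff z).1 hz]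
    have hunion := (hpre 1).union (σ 1 z) (mem_image_of_mem _ hzC) (hz0 ▸ mem_image_of_mem _ hzC)
      (hpre (-1))
    have hsec : doubleSection h (dropLast y) ∈ σ 1 '' C :=
      ⟨_, hxC, by simp only [σ, one_mul, doubleSection]⟩
    have hyσ : y ∈ σ 1 '' C ∪ σ (-1) '' C := by
      have hy' : y = (splitLast (d + 1)).symm (dropLast y, y (Fin.last (d + 1))) :=
        ((splitLast (d + 1)).symm_apply_apply y).symm
      rcases le_total 0 (y (Fin.last (d + 1))) with h0 | h0
      · left
        refine ⟨_, hxC, ?_⟩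
        simp only [σ]
        rw [← h1, Real.sqrt_sq h0, one_mul, ← hy']
      · right
        refine ⟨_, hxC, ?_⟩
        simp only [σ]
        rw [← h1, ← neg_sq, Real.sqrt_sq (neg_nonneg.2 h0), neg_one_mul, neg_neg, ← hy']
    have hsub : ∀ c : ℝ, c ^ 2 = 1 → σ c '' C ⊆
        doubleHypersurface h ∩ firstCoord (d + 1) ⁻¹' {firstCoord (d + 1) y} := by
      rintro c hc _ ⟨x, hxC, rfl⟩
      obtain ⟨hxD, hxf⟩ := hCD hxC
      have hd : dropLast (σ c x) = x := dropLast_splitLast_symm _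
      have hl : σ c x (Fin.last (d + 1)) = c * √(h x) := splitLast_symm_last _
      constructor
      · change σ c x (Fin.last (d + 1)) ^ 2 = h (dropLast (σ c x))
        rw [hd, hl, mul_pow, hc, one_mul, Real.sq_sqrt ((H.mem_iff x).1 hxD)]
      · change firstCoord d (dropLast (σ c x)) = firstCoord d (dropLast y)
        rw [hd]
        exact hxf
    exact hunion.subset_connectedComponentIn hyσ
      (union_subset (hsub 1 (by norm_num)) (hsub (-1) (by norm_num))) (Or.inl hsec)

theorem IsDefiningFunction.mem_criticalSet_frontier_iff (H : IsDefiningFunction D h)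
    {x : Euc (d + 1)} : x ∈ criticalSet (firstCoord d) (frontier D) ↔
      x ∈ frontier D ∧ ∀ v, fderiv ℝ h x v = 0 → firstCLM d v = 0 :=
  mem_criticalSet_iff (firstCLM d) H.contDiff H.mem_frontier_iff H.regular

theorem IsDefiningFunction.isMorseOn_frontier_iff (H : IsDefiningFunction D h) :
    IsMorseOn (firstCoord d) (frontier D) ↔ ∀ x ∈ frontier D,
      (∀ v, fderiv ℝ h x v = 0 → firstCLM d v = 0) → ∀ v, fderiv ℝ h x v = 0 →
        (∀ w, fderiv ℝ h x w = 0 → fderiv ℝ (fderiv ℝ h) x v w = 0) → v = 0 :=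
  isMorseOn_iff H.contDiff H.mem_frontier_iff H.regular (firstCLM_ne_zero d)

theorem firstCLM_splitLast_symm (v : Euc (d + 1)) (t : ℝ) :
    firstCLM (d + 1) ((splitLast (d + 1)).symm (v, t)) = firstCLM d v := by
  change firstCoord d (dropLast ((splitLast (d + 1)).symm (v, t))) = firstCoord d v
  rw [dropLast_splitLast_symm]

/-- Where y ≠ 0, every horizontal vector lifts to a tangent vector by solving 2yt = dh(v) for t, so
the first coordinate is not critical. Where y = 0, tangency only constrains the horizontal part, by
dh(v) = 0. -/
theorem IsDefiningFunction.critical_double (H : IsDefiningFunction D h) {p : Euc (d + 2)}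
    (hp : p ∈ doubleHypersurface h) :
    (∀ v, fderiv ℝ (doubleFun h) p v = 0 → firstCLM (d + 1) v = 0) ↔
      p (Fin.last (d + 1)) = 0 ∧ dropLast p ∈ frontier D ∧
        ∀ v, fderiv ℝ h (dropLast p) v = 0 → firstCLM d v = 0 := by
  have key := fderiv_doubleFun_splitLast_symm H.contDiff p
  constructor
  · intro hc
    have hl : p (Fin.last (d + 1)) = 0 := by
      by_contra hl
      let e : Euc (d + 1) := EuclideanSpace.single 0 1
      have h1 := hc ((splitLast (d + 1)).symm
        (e, fderiv ℝ h (dropLast p) e / (2 * p (Fin.last (d + 1))))) (by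
          rw [key]
          field_simp
          ring)
      rw [firstCLM_splitLast_symm] at h1
      simp [e, firstCLM] at h1
    refine ⟨hl, H.dropLast_mem_frontier hp hl, fun v hv => ?_⟩
    rw [← firstCLM_splitLast_symm v 0]
    exact hc _ (by rw [key, hv]; ring)
  · rintro ⟨hl, -, hc⟩ v hv
    obtain ⟨⟨v, t⟩, rfl⟩ := (splitLast (d + 1)).symm.surjective v
    rw [key, hl] at hv
    rw [firstCLM_splitLast_symm]
    exact hc v (by simpa using hv)

theorem IsDefiningFunction.mem_criticalSet_double_iff (H : IsDefiningFunction D h)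
    {p : Euc (d + 2)} : p ∈ criticalSet (firstCoord (d + 1)) (doubleHypersurface h) ↔
      p ∈ prodZero (criticalSet (firstCoord d) (frontier D)) := by
  have h1 := mem_criticalSet_iff (p := p) (firstCLM (d + 1)) (contDiff_doubleFun H.contDiff)
    mem_doubleHypersurface_iff H.regular_double
  rw [coe_firstCLM] at h1
  rw [h1]
  change _ ↔ dropLast p ∈ criticalSet (firstCoord d) (frontier D) ∧ p (Fin.last (d + 1)) = 0
  rw [H.mem_criticalSet_frontier_iff]
  constructor
  · rintro ⟨hp, hc⟩
    exact ((H.critical_double hp).1 hc).symm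
  · rintro ⟨hc, hl⟩
    have hp : p ∈ doubleHypersurface h := by
      change p (Fin.last (d + 1)) ^ 2 = h (dropLast p)
      rw [hl, (H.mem_frontier_iff _).1 hc.1]
      simp
    exact ⟨hp, (H.critical_double hp).2 ⟨hl, hc⟩⟩

/-- At a critical point the tangent space is ker dh × ℝ and d²F is block diagonal: -d²h on ker dh,
nondegenerate by assumption, and 2 on the vertical line. -/
theorem IsDefiningFunction.isMorseOn_double (H : IsDefiningFunction D h)
    (hD : IsMorseOn (firstCoord d) (frontier D)) :
    IsMorseOn (firstCoord (d + 1)) (doubleHypersurface h) := by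
  rw [H.isMorseOn_frontier_iff] at hD
  refine (isMorseOn_iff (l := firstCLM (d + 1)) (contDiff_doubleFun H.contDiff)
    mem_doubleHypersurface_iff H.regular_double (firstCLM_ne_zero _)).2 fun p hp hc v hv hvw => ?_
  obtain ⟨hl, hfr, hc⟩ := (H.critical_double hp).1 hc
  have key := fderiv_doubleFun_splitLast_symm H.contDiff p
  have hess : ∀ v t w r, fderiv ℝ (fderiv ℝ (doubleFun h)) p ((splitLast (d + 1)).symm (v, t))
      ((splitLast (d + 1)).symm (w, r)) =
        2 * t * r - fderiv ℝ (fderiv ℝ h) (dropLast p) v w := fun v t w r => by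
    rw [fderiv_fderiv_doubleFun H.contDiff]
    change 2 * (splitLast (d + 1)).symm (v, t) (Fin.last _) *
      (splitLast (d + 1)).symm (w, r) (Fin.last _) - fderiv ℝ (fderiv ℝ h) (dropLast p)
        (dropLast ((splitLast (d + 1)).symm (v, t)))
        (dropLast ((splitLast (d + 1)).symm (w, r))) = _
    simp only [dropLast_splitLast_symm, splitLast_symm_last]
  obtain ⟨⟨v, t⟩, rfl⟩ := (splitLast (d + 1)).symm.surjective v
  have ht : t = 0 := by
    have := hvw ((splitLast (d + 1)).symm (0, 1)) (by rw [key, hl]; simp)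
    rw [hess] at this
    simpa using this
  have hv0 : v = 0 := by
    refine hD _ hfr hc v (by rw [key, hl] at hv; simpa using hv) fun w hw => ?_
    have := hvw ((splitLast (d + 1)).symm (w, 0)) (by rw [key, hw, hl]; simp)
    rw [hess] at this
    simpa using this
  rw [hv0, ht, Prod.mk_zero_zero, map_zero]

/-- At y = 0 the vertical direction is tangent to the double, and it complements the horizontal
hyperplane. -/
theorem IsDefiningFunction.meetTransversally (H : IsDefiningFunction D h) :
    MeetTransversally (doubleHypersurface h) (prodZero univ) := by
  rintro p ⟨hp, hp'⟩ w
  have hl : p (Fin.last (d + 1)) = 0 := hp'.2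
  have hN : ∀ x : Euc (d + 2), x ∈ prodZero univ ↔ lastCLM (d + 1) x = 0 :=
    fun x => and_iff_right (mem_univ _)
  have hfd : fderiv ℝ (lastCLM (d + 1)) p = lastCLM (d + 1) := (lastCLM (d + 1)).fderiv
  have hlast : ∀ q, lastCLM (d + 1) ((splitLast (d + 1)).symm q) = q.2 := splitLast_symm_last
  obtain ⟨⟨v, t⟩, rfl⟩ := (splitLast (d + 1)).symm.surjective w
  refine ⟨(splitLast (d + 1)).symm (0, t), (splitLast (d + 1)).symm (v, 0), ?_, ?_, ?_⟩
  · rw [isTangentVector_iff hp (contDiff_doubleFun H.contDiff) mem_doubleHypersurface_iff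
      (H.regular_double p hp), fderiv_doubleFun_splitLast_symm H.contDiff, hl]
    simp
  · rw [isTangentVector_iff hp' (lastCLM (d + 1)).contDiff hN, hfd, hlast]
    rw [hfd]
    intro h0
    have := hlast (0, 1)
    rw [h0] at this
    simp at this
  · rw [← map_add]
    simp

/-- An unbounded edge of the double is the preimage of a component in `D`. That component is
unbounded too, by `isBounded_double`, so it would be an unbounded edge of `D`. -/
theorem IsDomainOfFiniteType.hasNoUnboundedEdges_double (hD : IsDomainOfFiniteType D) (hd : 1 ≤ d)
    (H : IsDefiningFunction D h)
    (hunb : HasNoUnboundedEdges D (firstCoord d) (criticalSet (firstCoord d) (frontier D)))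
    (hq : MapsTo dropLast (criticalSet (firstCoord (d + 1)) (doubleHypersurface h))
      (criticalSet (firstCoord d) (frontier D)))
    (hs : MapsTo (doubleSection h) (criticalSet (firstCoord d) (frontier D))
      (criticalSet (firstCoord (d + 1)) (doubleHypersurface h))) :
    HasNoUnboundedEdges (doubleHypersurface h) (firstCoord (d + 1))
      (criticalSet (firstCoord (d + 1)) (doubleHypersurface h)) := by
  have P := hD.isReebProjection hd H
  constructor
  · rintro v C ⟨hv, hC, hCb, hCK, hCv⟩
    obtain ⟨v, rfl⟩ := P.reebHomeomorph.surjective v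
    rw [P.reebHomeomorph_mem_reebVertices_iff hq hs] at hv
    rw [P.reebHeight_reebHomeomorph] at hC
    obtain ⟨C', hC', rfl⟩ : ∃ C',
        (IsComponentOf C' (D ∩ firstCoord d ⁻¹' Iio (reebHeight D (firstCoord d) v)) ∨
        IsComponentOf C' (D ∩ firstCoord d ⁻¹' Ioi (reebHeight D (firstCoord d) v))) ∧
        C = doubleHypersurface h ∩ dropLast ⁻¹' C' := by
      rcases hC with hC | hC
      · obtain ⟨C', hC', h'⟩ := P.exists_isComponentOf hC
        exact ⟨C', Or.inl hC', h'⟩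
      · obtain ⟨C', hC', h'⟩ := P.exists_isComponentOf hC
        exact ⟨C', Or.inr hC', h'⟩
    have hsub : C' ⊆ D := by
      rcases hC' with h' | h' <;> exact h'.subset.trans inter_subset_left
    exact hunb.1 v C' ⟨hv, hC', fun hb => hCb (H.isBounded_double hb),
      (P.disjoint_preimage_iff hq hs hsub).1 hCK, (P.closure_inter_reebFiber_iff hsub v).1 hCv⟩
  · rintro C ⟨hC, hCb, hCK⟩
    -- Components of the whole space are the case I = ℝ of the transfer.
    rw [← inter_univ (doubleHypersurface h), ← preimage_univ (f := firstCoord (d + 1))] at hC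
    obtain ⟨C', hC', rfl⟩ := P.exists_isComponentOf hC
    rw [preimage_univ, inter_univ] at hC'
    exact hunb.2 C' ⟨hC', fun hb => hCb (H.isBounded_double hb),
      (P.disjoint_preimage_iff hq hs hC'.subset).1 hCK⟩

end Level

end

theorem mainTheorem5 (d : ℕ) (hd : 1 ≤ d) (D : Set (Euc (d + 1)))
    (hD : IsDomainOfFiniteType D)
    {α β : Type*} (Γ : Graph α β)
    (hunb : HasNoUnboundedEdges D (firstCoord d) (criticalSet (firstCoord d) (frontier D)))
    (e : MultigraphIso Γ (poincareReebGraph D)) :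
    (∃ h : Euc (d + 1) → ℝ, IsDefiningFunction D h) ∧
    ∀ h : Euc (d + 1) → ℝ, IsDefiningFunction D h →
      IsClosed (doubleHypersurface h) ∧
      IsSmoothHypersurface (doubleHypersurface h) ∧
      MeetTransversally (doubleHypersurface h) (prodZero univ) ∧
      doubleHypersurface h ∩ prodZero univ = prodZero (frontier D) ∧
      IsMorseOn (firstCoord (d + 1)) (doubleHypersurface h) ∧
      HasNoUnboundedEdges (doubleHypersurface h) (firstCoord (d + 1))
        (criticalSet (firstCoord (d + 1)) (doubleHypersurface h)) ∧
      ∃ (Θ : PRSpace D ≃ₜ ReebSpace (doubleHypersurface h) (firstCoord (d + 1)))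
        (e' : MultigraphIso Γ
          (hypersurfaceReebGraph (doubleHypersurface h) (firstCoord (d + 1)))),
        (∀ q, reebHeight (doubleHypersurface h) (firstCoord (d + 1)) (Θ q) =
          reebHeight D (firstCoord d) q) ∧
        ∀ v : Γ.vertexSet, (e'.vertexEquiv v :
          ReebSpace (doubleHypersurface h) (firstCoord (d + 1))) = Θ (e.vertexEquiv v) := by
  refine ⟨hD.smooth.exists_isDefiningFunction, fun h H => ?_⟩
  have P := hD.isReebProjection hd H
  have hq : MapsTo dropLast (criticalSet (firstCoord (d + 1)) (doubleHypersurface h))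
      (criticalSet (firstCoord d) (frontier D)) :=
    fun p hp => (H.mem_criticalSet_double_iff.1 hp).1
  have hs : MapsTo (doubleSection h) (criticalSet (firstCoord d) (frontier D))
      (criticalSet (firstCoord (d + 1)) (doubleHypersurface h)) := fun x hx => by
    refine H.mem_criticalSet_double_iff.2 ⟨by rwa [P.proj_section], ?_⟩
    refine (splitLast_symm_last _).trans ?_
    rw [(H.mem_frontier_iff x).1 hx.1, Real.sqrt_zero]
  refine ⟨isClosed_doubleHypersurface H.contDiff, fun p hp => exists_isFlatteningChart
    (contDiff_doubleFun H.contDiff) mem_doubleHypersurface_iff (H.regular_double p hp),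
    H.meetTransversally, ?_, H.isMorseOn_double hD.morse,
    hD.hasNoUnboundedEdges_double hd H hunb hq hs, P.reebHomeomorph,
    -- The vertex bijection of `multigraphIso` is by definition the restriction of `reebHomeomorph`,
    -- which is Θ.
    e.trans (P.multigraphIso hq hs), P.reebHeight_reebHomeomorph, fun v => rfl⟩
  ext p
  constructor
  · rintro ⟨hp, -, hl⟩
    exact ⟨H.dropLast_mem_frontier hp hl, hl⟩
  · rintro ⟨hp, hl⟩
    refine ⟨?_, mem_univ _, hl⟩
    change p (Fin.last (d + 1)) ^ 2 = h (dropLast p)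
    rw [hl, (H.mem_frontier_iff _).1 hp]
    simp
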